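/- **Theorem 5 (Fermion parity switch).** Let $L\ge 2$ be even, let $t,\Delta,\mu,n_c\in\mathbb{R}$ with $|\mu|<t$, and let $\mathcal{E}_c\ge 0$. Consider a ring of $L$ sites carrying spinless fermions with annihilation operators $c_1,\dots,c_L$, coupled to a superconductor with Cooper pair number operator $\hat n$ (eigenstates $|p\rangle$, $p\in\mathbb{Z}$) and phase operator $\hat\phi$ (so that $e^{i\hat\phi}|p\rangle=|p+1\rangle$). Let $\hat N_w=\sum_{j=1}^L c_j^\dagger c_j$, let $\hat N=\hat N_w+2\hat n$ be the total particle number, and let $$\hat H_\mu=-\frac t2\sum_{j=1}^{L}\left(c_j^\dagger c_{j+1}+\text{h.c.}\right)-\frac\Delta2\sum_{j=1}^{L}\left(c_jc_{j+1}e^{i\hat\phi}+\text{h.c.}\right)-\mu\left(\hat N_w-\frac L2\right)+\frac{\mathcal{E}_c}{L}\,(2\hat n-2n_c)^2 ,$$ where $c_{L+1}=c_1$ for periodic and $c_{L+1}=-c_1$ for antiperiodic boundary conditions. Let $E_k=\sqrt{(t\cos k+\mu)^2+\Delta^2\sin^2k}$ and $E_{\min}=\min_{k\in[-\pi,\pi)}E_k$.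 If $$\mathcal{E}_c\left(\frac12+\frac9L\right)<E_{\min},$$ then the overall ground state of $\hat H_\mu$ (the eigenstate of lowest energy over all particle numbers) occurs in a sector with odd total particle number for periodic boundary conditions, and in a sector with even total particle number for antiperiodic boundary conditions (if there are several ground states, this holds for all of them). In both cases $\delta_{\text{parity}}$, the difference between the energy of the lowest eigenstate of opposite number parity and the energy of the overall ground state, satisfies $$\delta_{\text{parity}}\ \ge\ E_{\min}-\mathcal{E}_c\left(\frac12+\frac9L\right)=E_{\min}-\frac{\mathcal{E}_c}2+O\left(\frac1L\right),$$ and this holds for every such $L$. -/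

import Mathlib

/-! The number-conserving Kitaev ring with charging energy: a ring of `L` sites carrying spinless
fermions, coupled to a superconductor described by its Cooper pair number and phase. -/

noncomputable section

namespace KitaevRing

/-- Labels of the occupation basis `|S⟩ ⊗ |p⟩`: the set `S` of occupied sites of the wire (the sites
`1, …, L` are numbered `0, …, L - 1` here) and the number `p ∈ ℤ` of Cooper pairs. -/
abbrev Config (L : ℕ) : Type := Finset (Fin L) × ℤ

/-- The Hilbert space (fermionic Fock space of the wire) `⊗` (span of the `|p⟩`, `p ∈ ℤ`), as the
space of square-summable amplitudes in the occupation basis. -/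
abbrev HilbertSpace (L : ℕ) : Type := lp (fun _ : Config L => ℂ) 2

/-- Formal operators: linear maps on all families of amplitudes. Every operator below has only
finitely many nonzero entries in each row, so it acts on all such families. -/
abbrev FormalOp (L : ℕ) : Type := Module.End ℂ (Config L → ℂ)

/-- The sign `(-1)^(number of occupied sites before j)`, which makes operators of different sites
anticommute. -/
def jwSign {L : ℕ} (S : Finset (Fin L)) (j : Fin L) : ℂ :=
  (-1) ^ (S.filter (fun i => i < j)).card

/-- The fermionic annihilation operator `c_j`:
`c_j |S, p⟩ = ± |S \ {j}, p⟩` if `j ∈ S`, and `c_j |S, p⟩ = 0` otherwise. -/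
def annih {L : ℕ} (j : Fin L) : FormalOp L where
  toFun ψ := fun x => if j ∈ x.1 then 0 else jwSign x.1 j * ψ (insert j x.1, x.2)
  map_add' ψ χ := by
    funext x
    by_cases h : j ∈ x.1 <;> simp [h, mul_add]
  map_smul' a ψ := by
    funext x
    by_cases h : j ∈ x.1 <;> simp [h, mul_left_comm]

/-- The fermionic creation operator `c_j†`, the adjoint of `c_j`:
`c_j† |S, p⟩ = ± |S ∪ {j}, p⟩` if `j ∉ S`, and `c_j† |S, p⟩ = 0` otherwise. -/
def create {L : ℕ} (j : Fin L) : FormalOp L where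
  toFun ψ := fun x => if j ∈ x.1 then jwSign x.1 j * ψ (x.1.erase j, x.2) else 0
  map_add' ψ χ := by
    funext x
    by_cases h : j ∈ x.1 <;> simp [h, mul_add]
  map_smul' a ψ := by
    funext x
    by_cases h : j ∈ x.1 <;> simp [h, mul_left_comm]

/-- The shift of the Cooper pair number by `d`: `|S, p⟩ ↦ |S, p + d⟩`. It is `e^{i d φ}`, with `φ`
the phase operator conjugate to the Cooper pair number. -/
def expPhase {L : ℕ} (d : ℤ) : FormalOp L where
  toFun ψ := fun x => ψ (x.1, x.2 - d)
  map_add' _ _ := rfl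
  map_smul' _ _ := rfl

/-- The Cooper pair number operator `n`. -/
def pairNumber (L : ℕ) : FormalOp L where
  toFun ψ := fun x => (x.2 : ℂ) * ψ x
  map_add' ψ χ := by
    funext x
    simp [mul_add]
  map_smul' a ψ := by
    funext x
    simp [mul_left_comm]

/-- The number of fermions on the wire, `N_w = ∑_j c_j† c_j`. -/
def wireNumber (L : ℕ) : FormalOp L := ∑ j : Fin L, create j * annih j

/-- The total particle number `N = N_w + 2 n`. -/
def totalNumber (L : ℕ) : FormalOp L := wireNumber L + (2 : ℂ) • pairNumber L

/-- The total number parity `(-1)^N`. -/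
def numberParity (L : ℕ) : FormalOp L where
  toFun ψ := fun x => (-1 : ℂ) ^ ((x.1.card : ℤ) + 2 * x.2) * ψ x
  map_add' ψ χ := by
    funext x
    simp [mul_add]
  map_smul' a ψ := by
    funext x
    simp [mul_left_comm]

/-- Periodic or antiperiodic boundary conditions. -/
inductive Boundary : Type
  | periodic
  | antiperiodic

/-- The sign `σ` in the identification `c_{L+1} = σ c_1`. -/
def Boundary.sign : Boundary → ℂ
  | .periodic => 1
  | .antiperiodic => -1

/-- `c_{j+1}`, with `c_{L+1} = σ c_1`. -/
def annihNext {L : ℕ} (b : Boundary) (j : Fin L) : FormalOp L :=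
  if h : j.val + 1 < L then annih ⟨j.val + 1, h⟩
  else b.sign • annih ⟨0, Nat.zero_lt_of_lt j.isLt⟩

/-- `c_{j+1}†`, with `c_{L+1}† = σ c_1†`. -/
def createNext {L : ℕ} (b : Boundary) (j : Fin L) : FormalOp L :=
  if h : j.val + 1 < L then create ⟨j.val + 1, h⟩
  else b.sign • create ⟨0, Nat.zero_lt_of_lt j.isLt⟩

/-- The Hamiltonian without charging energy,
`H_0 = -(t/2) ∑_j (c_j† c_{j+1} + h.c.) - (Δ/2) ∑_j (c_j c_{j+1} e^{iφ} + h.c.) - μ (N_w - L/2)`. -/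
def formalH0 (L : ℕ) (b : Boundary) (t Δ μ : ℝ) : FormalOp L :=
  (-((t : ℂ) / 2)) • ∑ j : Fin L, (create j * annihNext b j + createNext b j * annih j)
    + (-((Δ : ℂ) / 2)) • ∑ j : Fin L,
        (annih j * annihNext b j * expPhase 1 + expPhase (-1) * createNext b j * create j)
    + (-(μ : ℂ)) • (wireNumber L - ((L : ℂ) / 2) • (1 : FormalOp L))

/-- The charging energy `V = E_c (2 n - 2 n_c)²`. Since `2 n = N - N_w`, on the sector `N = M` it
is `E_c (N_w - (M - 2 n_c))²`. -/
def chargingEnergy (L : ℕ) (Ec nc : ℝ) : FormalOp L :=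
  (Ec : ℂ) • ((2 : ℂ) • pairNumber L - (2 * (nc : ℂ)) • (1 : FormalOp L)) ^ 2

/-- The operator on the Hilbert space given by a formal operator `A`, with its maximal domain
`{ψ ∈ ℓ² | A ψ ∈ ℓ²}`. -/
def maximalOp {L : ℕ} (A : FormalOp L) : HilbertSpace L →ₗ.[ℂ] HilbertSpace L where
  domain :=
    { carrier := {ψ | Memℓp (A (ψ : Config L → ℂ)) 2}
      zero_mem' := by
        change Memℓp (A ((0 : HilbertSpace L) : Config L → ℂ)) 2
        rw [lp.coeFn_zero, map_zero]
        exact zero_memℓp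
      add_mem' := by
        intro ψ χ hψ hχ
        change Memℓp (A ((ψ + χ : HilbertSpace L) : Config L → ℂ)) 2
        rw [lp.coeFn_add, map_add]
        exact Memℓp.add hψ hχ
      smul_mem' := by
        intro a ψ hψ
        change Memℓp (A ((a • ψ : HilbertSpace L) : Config L → ℂ)) 2
        rw [lp.coeFn_smul, map_smul]
        exact Memℓp.const_smul hψ a }
  toFun :=
    { toFun := fun ψ => ⟨A ((ψ : HilbertSpace L) : Config L → ℂ), ψ.2⟩
      map_add' := by
        intro ψ χ
        apply Subtype.ext
        exact map_add A _ _
      map_smul' := by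
        intro a ψ
        apply Subtype.ext
        exact map_smul A a _ }

/-- The Hamiltonian `H_μ = H_0 + V` of the ring of `L` sites, with charging energy
`E_c = 𝓔_c / L` (the parameter `Ecal` is `𝓔_c`). -/
def hamiltonian (L : ℕ) (b : Boundary) (t Δ μ Ecal nc : ℝ) :
    HilbertSpace L →ₗ.[ℂ] HilbertSpace L :=
  maximalOp (formalH0 L b t Δ μ + chargingEnergy L (Ecal / L) nc)

/-- `ψ` is an eigenstate of `H` with energy `E`. -/
def IsEigenstate {L : ℕ} (H : HilbertSpace L →ₗ.[ℂ] HilbertSpace L) (E : ℝ)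
    (ψ : HilbertSpace L) : Prop :=
  ψ ≠ 0 ∧ ∃ hψ : ψ ∈ H.domain, H ⟨ψ, hψ⟩ = (E : ℂ) • ψ

/-- `ψ` is a ground state of `H` with energy `E`: an eigenstate whose energy is the lowest of all
energies of eigenstates. -/
def IsGroundState {L : ℕ} (H : HilbertSpace L →ₗ.[ℂ] HilbertSpace L) (E : ℝ)
    (ψ : HilbertSpace L) : Prop :=
  IsEigenstate H E ψ ∧ ∀ (E' : ℝ) (χ : HilbertSpace L), IsEigenstate H E' χ → E ≤ E'

/-- `ψ` lies in the `M`-particle sector, `N ψ = M ψ`. -/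
def InSector {L : ℕ} (M : ℤ) (ψ : HilbertSpace L) : Prop :=
  totalNumber L (ψ : Config L → ℂ) = (M : ℂ) • (ψ : Config L → ℂ)

/-- `ψ` has even total number parity, `(-1)^N ψ = ψ`. -/
def EvenParity {L : ℕ} (ψ : HilbertSpace L) : Prop :=
  numberParity L (ψ : Config L → ℂ) = (ψ : Config L → ℂ)

/-- `ψ` has odd total number parity, `(-1)^N ψ = -ψ`. -/
def OddParity {L : ℕ} (ψ : HilbertSpace L) : Prop :=
  numberParity L (ψ : Config L → ℂ) = -(ψ : Config L → ℂ)

/-- `E_k = √((t cos k + μ)² + Δ² sin² k)`. -/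
def dispersion (t Δ μ k : ℝ) : ℝ :=
  Real.sqrt ((t * Real.cos k + μ) ^ 2 + Δ ^ 2 * Real.sin k ^ 2)

/-- `E_min = min_{k ∈ [-π, π)} E_k`; the minimum is attained, see `isLeast_minDispersion`. -/
def minDispersion (t Δ μ : ℝ) : ℝ :=
  sInf (dispersion t Δ μ '' Set.Ico (-Real.pi) Real.pi)

theorem isLeast_minDispersion (t Δ μ : ℝ) :
    IsLeast (dispersion t Δ μ '' Set.Ico (-Real.pi) Real.pi) (minDispersion t Δ μ) := by
  have hper : Function.Periodic (dispersion t Δ μ) (2 * Real.pi) := by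
    intro k
    simp [dispersion]
  have hcont : Continuous (dispersion t Δ μ) := by
    unfold dispersion
    fun_prop
  have himg : dispersion t Δ μ '' Set.Ico (-Real.pi) Real.pi
      = dispersion t Δ μ '' Set.Icc (-Real.pi) Real.pi := by
    apply Set.Subset.antisymm (Set.image_mono Set.Ico_subset_Icc_self)
    rintro _ ⟨k, hk, rfl⟩
    rcases hk.2.lt_or_eq with h | h
    · exact ⟨k, ⟨hk.1, h⟩, rfl⟩
    · refine ⟨-Real.pi, ⟨le_refl _, by linarith [Real.pi_pos]⟩, ?_⟩
      rw [h, ← hper (-Real.pi)]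
      congr 1
      ring
  rw [minDispersion, himg]
  refine (isCompact_Icc.image hcont).isLeast_sInf ?_
  exact (Set.nonempty_Icc.2 (by linarith [Real.pi_pos])).image _

end KitaevRing

end

set_option linter.unusedSectionVars false

noncomputable section

/-! The total number `N` is conserved. In the sector `N = M` the wire configuration `S` determines
the pair number `(M - |S|)/2`, so a state of the sector is a Fock state of the wire of fermion
parity `M` mod 2, and the phase factors disappear. There the Hamiltonian is the mean-field Kitaev
ring plus `E_c (N_w - (M - 2 n_c))²`, and it remains to compare the lowest energies of the two
parities.

Without charging energy: in momentum space the commutator with `kitaev` mixes `c_k` only with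
`c_{-k}†`, and suitable combinations lower the energy by `E_k ≥ E_min`. A vacuum, killed by all of
these, has equal occupations of `k` and `-k`, is occupied at `k = 0` and empty at `k = π` (this is
where `|μ| < t` enters). Its parity is therefore decided by whether `k = 0` is an allowed momentum:
odd for periodic, even for antiperiodic boundary conditions (`IsVacuum.parity_eq`). An eigenstate of
the other parity is not a vacuum, so it can be lowered, which gives the gap `E_min` (`kitaev_gap`);
conversely the lowest state of the right parity is a vacuum (`exists_vacuum`).

With charging energy: for the wrong parity the charging term is dropped, being nonnegative. For the
right parity the vacuum is a trial state. The occupations of different pairs `{k, -k}` are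
uncorrelated in it, so `N_w` has variance at most `L/2` (`IsVacuum.inner_siteNumber_sq_le`), and
some `M` of the right parity puts the centre of the parabola within 1 of the mean. The charging
energy thus costs at most `E_c (L/2 + 1) = 𝓔_c (1/2 + 1/L)`, and the gap survives up to this amount.
-/

namespace KitaevRing

open scoped InnerProductSpace

variable {L : ℕ} {b : Boundary}

/-! ### Fock space of the wire and the canonical anticommutation relations -/

/-- The fermionic Fock space of the wire, in the occupation basis. -/
abbrev Fock (L : ℕ) : Type := EuclideanSpace ℂ (Finset (Fin L))

/-- The canonical anticommutation relations. -/
structure IsCAR {R ι : Type*} [Ring R] [StarRing R] [DecidableEq ι] (c : ι → R) : Prop where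
  anti : ∀ i j, c i * c j = -(c j * c i)
  anti_star : ∀ i j, c i * star (c j) = (if i = j then 1 else 0) - star (c j) * c i

/-- The annihilation operator of a site, on Fock space. -/
def siteAnnih (j : Fin L) : Module.End ℂ (Fock L) where
  toFun φ := WithLp.toLp 2 fun S => if j ∈ S then 0 else jwSign S j * φ (insert j S)
  map_add' φ χ := by
    ext S
    by_cases h : j ∈ S <;> simp [h, mul_add]
  map_smul' a φ := by
    ext S
    by_cases h : j ∈ S <;> simp [h, mul_left_comm]

/-- The creation operator of a site, on Fock space. -/
def siteCreate (j : Fin L) : Module.End ℂ (Fock L) where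
  toFun φ := WithLp.toLp 2 fun S => if j ∈ S then jwSign S j * φ (S.erase j) else 0
  map_add' φ χ := by
    ext S
    by_cases h : j ∈ S <;> simp [h, mul_add]
  map_smul' a φ := by
    ext S
    by_cases h : j ∈ S <;> simp [h, mul_left_comm]

theorem siteAnnih_apply (j : Fin L) (φ : Fock L) (S : Finset (Fin L)) :
    siteAnnih j φ S = if j ∈ S then 0 else jwSign S j * φ (insert j S) := rfl

theorem siteCreate_apply (j : Fin L) (φ : Fock L) (S : Finset (Fin L)) :
    siteCreate j φ S = if j ∈ S then jwSign S j * φ (S.erase j) else 0 := rfl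

theorem star_jwSign (S : Finset (Fin L)) (j : Fin L) : star (jwSign S j) = jwSign S j := by
  simp [jwSign]

theorem jwSign_mul_self (S : Finset (Fin L)) (j : Fin L) : jwSign S j * jwSign S j = 1 := by
  rw [jwSign, ← pow_add, Even.neg_one_pow ⟨_, rfl⟩]

theorem jwSign_insert_of_lt {S : Finset (Fin L)} {i j : Fin L} (hi : i ∉ S) (hij : i < j) :
    jwSign (insert i S) j = -jwSign S j := by
  rw [jwSign, jwSign, Finset.filter_insert, if_pos hij, Finset.card_insert_of_notMem (by simp [hi])]
  ring

theorem jwSign_insert_of_le (S : Finset (Fin L)) {i j : Fin L} (hij : j ≤ i) :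
    jwSign (insert i S) j = jwSign S j := by
  rw [jwSign, jwSign, Finset.filter_insert, if_neg hij.not_gt]

theorem jwSign_erase_of_lt {S : Finset (Fin L)} {i j : Fin L} (hi : i ∈ S) (hij : i < j) :
    jwSign (S.erase i) j = -jwSign S j := by
  conv_rhs => rw [← Finset.insert_erase hi]
  rw [jwSign_insert_of_lt (by simp) hij, neg_neg]

theorem jwSign_erase_of_le (S : Finset (Fin L)) {i j : Fin L} (hij : j ≤ i) :
    jwSign (S.erase i) j = jwSign S j := by
  by_cases hi : i ∈ S
  · conv_rhs => rw [← Finset.insert_erase hi]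
    rw [jwSign_insert_of_le _ hij]
  · rw [Finset.erase_eq_of_notMem hi]

/-- The two inner products run over sets that contain `j` and sets that do not; erasing and
inserting `j` matches them term by term. -/
theorem star_siteAnnih (j : Fin L) : star (siteAnnih j) = siteCreate j := by
  symm
  rw [LinearMap.star_eq_adjoint, LinearMap.eq_adjoint_iff]
  intro φ χ
  simp only [PiLp.inner_apply, RCLike.inner_apply, siteAnnih_apply, siteCreate_apply]
  rw [← Finset.sum_filter_add_sum_filter_not Finset.univ (fun S : Finset (Fin L) => j ∈ S),
    ← Finset.sum_filter_add_sum_filter_not (s := Finset.univ) (p := fun S : Finset (Fin L) => j ∈ S)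
      (f := fun S => (if j ∈ S then 0 else jwSign S j * χ (insert j S)) * _)]
  rw [Finset.sum_eq_zero (s := Finset.univ.filter fun S : Finset (Fin L) => ¬ j ∈ S), add_zero,
    Finset.sum_eq_zero (s := Finset.univ.filter fun S : Finset (Fin L) => j ∈ S)
      (f := fun S => (if j ∈ S then 0 else jwSign S j * χ (insert j S)) * _), zero_add]
  · refine Finset.sum_nbij' (fun S => S.erase j) (fun S => insert j S) ?_ ?_ ?_ ?_ ?_
    · intro S hS; simp
    · intro S hS; simp
    · intro S hS; simp only [Finset.mem_filter, Finset.mem_univ, true_and] at hS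
      exact Finset.insert_erase hS
    · intro S hS; simp only [Finset.mem_filter, Finset.mem_univ, true_and] at hS
      exact Finset.erase_insert hS
    · intro S hS
      simp only [Finset.mem_filter, Finset.mem_univ, true_and] at hS
      have h := star_jwSign S j
      rw [if_pos hS, if_neg (by simp), jwSign_erase_of_le _ le_rfl, Finset.insert_erase hS,
        map_mul, starRingEnd_apply, h]
      ring
  · intro S hS
    simp only [Finset.mem_filter, Finset.mem_univ, true_and] at hS
    simp [hS]
  · intro S hS
    simp only [Finset.mem_filter, Finset.mem_univ, true_and] at hS
    simp [hS]

/-- For two different sites only the sign string of the later site sees the occupation of the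
earlier one, so exchanging the operators flips exactly one sign. -/
theorem isCAR_siteAnnih : IsCAR (siteAnnih : Fin L → Module.End ℂ (Fock L)) where
  anti i j := by
    ext φ S
    rw [LinearMap.neg_apply, PiLp.neg_apply, Module.End.mul_apply, Module.End.mul_apply]
    simp only [siteAnnih_apply]
    rcases eq_or_ne i j with rfl | hij
    · simp
    · by_cases hi : i ∈ S
      · simp [hi]
      by_cases hj : j ∈ S
      · simp [hj]
      rw [if_neg hi, if_neg hj, if_neg (by simp [hj, hij.symm]), if_neg (by simp [hi, hij]),
        Finset.insert_comm]
      rcases hij.lt_or_gt with h | h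
      · rw [jwSign_insert_of_lt hi h, jwSign_insert_of_le _ h.le]; ring
      · rw [jwSign_insert_of_lt hj h, jwSign_insert_of_le _ h.le]; ring
  anti_star i j := by
    rw [star_siteAnnih]
    ext φ S
    rw [LinearMap.sub_apply, PiLp.sub_apply, Module.End.mul_apply, Module.End.mul_apply]
    simp only [siteAnnih_apply, siteCreate_apply]
    rcases eq_or_ne i j with rfl | hij
    · rw [if_pos rfl]
      by_cases hi : i ∈ S
      · rw [if_pos hi, if_pos hi, if_neg (by simp), jwSign_erase_of_le _ le_rfl,
          Finset.insert_erase hi, ← mul_assoc, jwSign_mul_self]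
        simp
      · rw [if_neg hi, if_neg hi, if_pos (by simp), jwSign_insert_of_le _ le_rfl,
          Finset.erase_insert hi, ← mul_assoc, jwSign_mul_self]
        simp
    · rw [if_neg hij]
      by_cases hi : i ∈ S
      · simp [hi, Finset.mem_erase, hij]
      by_cases hj : j ∈ S
      · rw [if_neg hi, if_pos (by simp [hj]), if_pos hj, if_neg (by simp [hi]),
          Finset.erase_insert_of_ne hij]
        rcases hij.lt_or_gt with h | h
        · rw [jwSign_insert_of_lt hi h, jwSign_erase_of_le _ h.le]; simp; ring
        · rw [jwSign_erase_of_lt hj h, jwSign_insert_of_le _ h.le]; simp; ring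
      · simp [hi, hj, hij.symm]

theorem Boundary.star_sign (b : Boundary) : star b.sign = b.sign := by
  cases b <;> simp [Boundary.sign]

theorem Boundary.sign_mul_self (b : Boundary) : b.sign * b.sign = 1 := by
  cases b <;> simp [Boundary.sign]

/-! ### Momenta and plane waves -/

/-- The momenta of a ring of `L` sites, represented by the phases `z = e^{ik}`. -/
abbrev Momentum (L : ℕ) (b : Boundary) : Type :=
  {z : ℂ // z ∈ Polynomial.nthRootsFinset L b.sign}

namespace Momentum

theorem pow_eq [NeZero L] (z : Momentum L b) : (z : ℂ) ^ L = b.sign :=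
  (Polynomial.mem_nthRootsFinset (NeZero.pos L) _).1 z.2

theorem star_mul_self [NeZero L] (z : Momentum L b) : star (z : ℂ) * z = 1 := by
  have h : ‖(z : ℂ)‖ ^ L = 1 := by
    rw [← norm_pow, pow_eq]
    cases b <;> simp [Boundary.sign]
  have h' : ‖(z : ℂ)‖ = 1 := (pow_eq_one_iff_of_nonneg (norm_nonneg _) (NeZero.ne L)).1 h
  have := Complex.conj_mul' (z : ℂ)
  rw [h'] at this
  simpa using this

/-- The opposite momentum. -/
def neg [NeZero L] (z : Momentum L b) : Momentum L b :=
  ⟨star (z : ℂ), by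
    rw [Polynomial.mem_nthRootsFinset (NeZero.pos L), ← star_pow, pow_eq, Boundary.star_sign]⟩

theorem coe_neg [NeZero L] (z : Momentum L b) : (z.neg : ℂ) = star (z : ℂ) := rfl

theorem neg_neg [NeZero L] (z : Momentum L b) : z.neg.neg = z :=
  Subtype.ext (star_star (z : ℂ))

theorem neg_eq_iff [NeZero L] {z w : Momentum L b} : z.neg = w ↔ z = w.neg :=
  ⟨fun h => by rw [← h, neg_neg], fun h => by rw [h, neg_neg]⟩

theorem sum_neg [NeZero L] {M : Type*} [AddCommMonoid M] (f : Momentum L b → M) :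
    ∑ z, f (neg z) = ∑ z, f z :=
  Fintype.sum_equiv ⟨neg, neg, neg_neg, neg_neg⟩ _ _ fun _ => rfl

theorem card [NeZero L] : Fintype.card (Momentum L b) = L := by
  have hp := Complex.isPrimitiveRoot_exp L (NeZero.ne L)
  have hne : b.sign ≠ 0 := by cases b <;> simp [Boundary.sign]
  rw [Fintype.card_coe, Polynomial.nthRootsFinset_def,
    Multiset.toFinset_card_of_nodup (hp.nthRoots_nodup hne), hp.card_nthRoots, if_pos]
  exact IsAlgClosed.exists_pow_nat_eq _ (NeZero.pos L)

end Momentum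

/-- The normalized plane wave of momentum `z`. -/
def wave (z : Momentum L b) (j : Fin L) : ℂ := ((√L : ℝ) : ℂ)⁻¹ * star (z : ℂ) ^ (j : ℕ)

theorem star_wave [NeZero L] (z : Momentum L b) (j : Fin L) : star (wave z j) = wave z.neg j := by
  simp [wave, Momentum.coe_neg]

/-- A geometric sum whose ratio has `L`-th power `σ² = 1`. -/
theorem sum_wave_mul_star [NeZero L] (z w : Momentum L b) :
    ∑ j, wave z j * star (wave w j) = if z = w then 1 else 0 := by
  have hL : ((√L : ℝ) : ℂ)⁻¹ * ((√L : ℝ) : ℂ)⁻¹ * L = 1 := by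
    rw [← mul_inv, ← Complex.ofReal_mul, Real.mul_self_sqrt (Nat.cast_nonneg L)]
    simp [NeZero.ne L]
  have h1 : ∀ j : Fin L, wave z j * star (wave w j)
      = ((√L : ℝ) : ℂ)⁻¹ * ((√L : ℝ) : ℂ)⁻¹ * (star (z : ℂ) * w) ^ (j : ℕ) := by
    intro j
    simp only [wave, star_mul', star_pow, star_star, mul_pow]
    simp
    ring
  rw [Finset.sum_congr rfl fun j _ => h1 j, ← Finset.mul_sum,
    Fin.sum_univ_eq_sum_range (fun j => (star (z : ℂ) * w) ^ j)]
  rcases eq_or_ne z w with rfl | h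
  · simp only [Momentum.star_mul_self, one_pow, Finset.sum_const, Finset.card_range, nsmul_eq_mul,
      mul_one, if_true]
    exact hL
  · rw [if_neg h, geom_sum_eq, mul_pow, ← star_pow, Momentum.pow_eq, Momentum.pow_eq,
      Boundary.star_sign, Boundary.sign_mul_self]
    · simp
    · intro h'
      apply h
      apply Subtype.ext
      have := Momentum.star_mul_self z
      calc (z : ℂ) = (z : ℂ) * (star (z : ℂ) * w) := by rw [h', mul_one]
        _ = (star (z : ℂ) * z) * w := by ring
        _ = w := by rw [this, one_mul]

/-- Completeness follows from orthonormality because there are exactly `L` momenta: the matrix of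
waves is square, so its right inverse is a left inverse. -/
theorem sum_star_wave_mul [NeZero L] (i j : Fin L) :
    ∑ z : Momentum L b, star (wave z i) * wave z j = if i = j then 1 else 0 := by
  let U : Matrix (Momentum L b) (Fin L) ℂ := Matrix.of wave
  have h : U * U.conjTranspose = 1 := by
    ext z w
    rw [Matrix.mul_apply, Matrix.one_apply]
    exact sum_wave_mul_star z w
  have h' : U.conjTranspose * U = 1 :=
    (Matrix.mul_eq_one_comm_of_card_eq _ _ _ (by rw [Momentum.card, Fintype.card_fin])).1 h
  have := congrFun (congrFun h' i) j
  rw [Matrix.mul_apply, Matrix.one_apply] at this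
  exact this

theorem sum_smul_mul_sum_smul {R ι κ : Type*} [Ring R] [Algebra ℂ R] [Fintype ι] [Fintype κ]
    (f : ι → ℂ) (x : ι → R) (g : κ → ℂ) (y : κ → R) :
    (∑ i, f i • x i) * ∑ j, g j • y j = ∑ i, ∑ j, (f i * g j) • (x i * y j) := by
  simp only [Finset.sum_mul_sum, smul_mul_smul_comm]

/-! ### The Kitaev ring in momentum space -/

section Algebra

variable {R : Type*} [Ring R] [StarRing R] [Algebra ℂ R] [StarModule ℂ R]

/-- The family `c_{j+1}`, with `c_{L+1} = σ c_1`. -/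
def next (b : Boundary) (c : Fin L → R) (j : Fin L) : R :=
  if h : j.val + 1 < L then c ⟨j.val + 1, h⟩ else b.sign • c ⟨0, Nat.zero_lt_of_lt j.isLt⟩

/-- The annihilation operator of a momentum mode. -/
def mode (c : Fin L → R) (z : Momentum L b) : R := ∑ j, wave z j • c j

/-- The Kitaev ring Hamiltonian, without the phase of the superconductor. -/
def kitaev (b : Boundary) (c : Fin L → R) (t Δ μ : ℝ) : R :=
  (-((t : ℂ) / 2)) • ∑ j, (star (c j) * next b c j + star (next b c j) * c j)
    + (-((Δ : ℂ) / 2)) • ∑ j, (c j * next b c j + star (next b c j) * star (c j))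
    + (-(μ : ℂ)) • (∑ j, star (c j) * c j - ((L : ℂ) / 2) • (1 : R))

theorem kitaev_isSelfAdjoint (b : Boundary) (c : Fin L → R) (t Δ μ : ℝ) :
    star (kitaev b c t Δ μ) = kitaev b c t Δ μ := by
  simp only [kitaev, star_add, star_smul, star_sub, star_sum, star_mul, star_star, star_one]
  simp [add_comm]

/-- Translation by one site is multiplication by `z`. The term that wraps around the ring fits
because `z ^ L = σ`, so both boundary conditions are treated alike. -/
theorem sum_wave_smul_next [NeZero L] (c : Fin L → R) (z : Momentum L b) :
    ∑ j, wave z j • next b c j = (z : ℂ) • mode c z := by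
  obtain ⟨n, rfl⟩ := Nat.exists_eq_succ_of_ne_zero (NeZero.ne L)
  have hz := Momentum.star_mul_self z
  have hp := Momentum.pow_eq z
  have hs := Boundary.sign_mul_self b
  rw [mode, Finset.smul_sum, Fin.sum_univ_castSucc, Fin.sum_univ_succ, add_comm]
  congr 1
  · rw [next, dif_neg (by simp), smul_smul, smul_smul]
    congr 1
    have h1 : star (z : ℂ) ^ n * b.sign = z := by
      calc star (z : ℂ) ^ n * b.sign = (star (z : ℂ) * z) ^ n * z := by
            rw [mul_pow, mul_assoc, ← pow_succ]
            exact congrArg _ hp.symm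
        _ = z := by rw [hz, one_pow, one_mul]
    simp only [wave, Fin.val_last, Fin.val_zero, pow_zero, mul_one]
    rw [mul_assoc, h1, mul_comm]
  · refine Finset.sum_congr rfl fun j _ => ?_
    rw [next, dif_pos (by simp), smul_smul]
    have h1 : wave z j.castSucc = (z : ℂ) * wave z j.succ := by
      simp only [wave, Fin.val_castSucc, Fin.val_succ, pow_succ]
      linear_combination (-(((√(n.succ : ℝ) : ℝ) : ℂ)⁻¹ * star (z : ℂ) ^ (j : ℕ))) * hz
    rw [h1]
    rfl

theorem sum_star_wave_smul_next [NeZero L] (c : Fin L → R) (z : Momentum L b) :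
    ∑ j, star (wave z j) • next b c j = star (z : ℂ) • mode c z.neg := by
  simp only [star_wave]
  exact sum_wave_smul_next c z.neg

theorem star_mode (c : Fin L → R) (z : Momentum L b) :
    star (mode c z) = ∑ j, star (wave z j) • star (c j) := by
  simp only [mode, star_sum, star_smul]

theorem sum_wave_completeness [NeZero L] (x y : Fin L → R) :
    ∑ z : Momentum L b, (∑ j, star (wave z j) • x j) * ∑ j, wave z j • y j
      = ∑ j, x j * y j := by
  simp only [sum_smul_mul_sum_smul]
  rw [Finset.sum_comm]
  refine Finset.sum_congr rfl fun i _ => ?_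
  rw [Finset.sum_comm]
  simp only [← Finset.sum_smul, sum_star_wave_mul, ite_smul, one_smul, zero_smul]
  simp

theorem sum_wave_completeness' [NeZero L] (x y : Fin L → R) :
    ∑ z : Momentum L b, (∑ j, wave z j • x j) * ∑ j, star (wave z j) • y j
      = ∑ j, x j * y j := by
  rw [← sum_wave_completeness (b := b), ← Momentum.sum_neg]
  simp only [star_wave, Momentum.neg_neg]

theorem sum_star_mode_mul_mode [NeZero L] (c : Fin L → R) :
    ∑ z : Momentum L b, star (mode c z) * mode c z = ∑ j, star (c j) * c j := by
  simp only [star_mode]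
  exact sum_wave_completeness _ _

theorem sum_star_mul_next [NeZero L] (c : Fin L → R) :
    ∑ j, star (c j) * next b c j
      = ∑ z : Momentum L b, (z : ℂ) • (star (mode c z) * mode c z) := by
  rw [← sum_wave_completeness (b := b)]
  simp only [← star_mode, sum_wave_smul_next, mul_smul_comm]

theorem sum_mul_next [NeZero L] (c : Fin L → R) :
    ∑ j, c j * next b c j
      = ∑ z : Momentum L b, star (z : ℂ) • (mode c z * mode c z.neg) := by
  rw [← sum_wave_completeness' (b := b)]
  simp only [sum_star_wave_smul_next, mul_smul_comm]
  rfl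

/-- The sum runs over all momenta, not over half of them, so the self-opposite momenta `z = ±1` need
no separate treatment. -/
theorem kitaev_eq_sum_mode [NeZero L] (c : Fin L → R) (t Δ μ : ℝ) :
    kitaev b c t Δ μ = ∑ z : Momentum L b,
        ((-(t * (z : ℂ).re + μ : ℝ) : ℂ) • (star (mode c z) * mode c z)
          + (-((Δ : ℂ) / 2)) • (star (z : ℂ) • (mode c z * mode c z.neg)
              + (z : ℂ) • (star (mode c z.neg) * star (mode c z))))
      + ((μ : ℂ) * L / 2) • (1 : R) := by
  have h1 := sum_star_mul_next (b := b) c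
  have h2 := congrArg star h1
  have h3 := sum_mul_next (b := b) c
  have h4 := congrArg star h3
  simp only [star_sum, star_mul, star_smul, star_star] at h2 h4
  rw [kitaev, Finset.sum_add_distrib, Finset.sum_add_distrib, h1, h2, h3, h4,
    ← sum_star_mode_mul_mode (b := b)]
  simp only [smul_add, Finset.smul_sum, Finset.sum_add_distrib, smul_sub, smul_smul]
  have h5 : ∀ z : Momentum L b, (-(t * (z : ℂ).re + μ : ℝ) : ℂ)
      = -((t : ℂ) / 2) * z + -((t : ℂ) / 2) * star (z : ℂ) + -(μ : ℂ) := by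
    intro z
    have : (((z : ℂ).re : ℝ) : ℂ) = (z + star (z : ℂ)) / 2 := by
      rw [Complex.re_eq_add_conj]; rfl
    push_cast
    rw [this]
    ring
  simp only [h5, add_smul, Finset.sum_add_distrib]
  have h6 : -(μ : ℂ) * (L / 2) = -((μ : ℂ) * L / 2) := by ring
  rw [h6, neg_smul]
  abel

end Algebra

/-! ### Moving quadratic expressions past a single operator -/

namespace IsCAR

variable {R ι : Type*} [Ring R] [StarRing R] [DecidableEq ι] {c : ι → R}

theorem star_mul (hc : IsCAR c) (i j : ι) :
    star (c i) * c j = (if i = j then 1 else 0) - c j * star (c i) := by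
  rw [hc.anti_star]
  simp only [eq_comm]
  abel

theorem star_anti (hc : IsCAR c) (i j : ι) :
    star (c i) * star (c j) = -(star (c j) * star (c i)) := by
  rw [← StarMul.star_mul, hc.anti, star_neg, StarMul.star_mul]

theorem number_mul (hc : IsCAR c) (i j : ι) :
    star (c i) * c i * c j = c j * (star (c i) * c i) - if i = j then c i else 0 := by
  rw [mul_assoc, hc.anti, mul_neg, ← mul_assoc, hc.star_mul, sub_mul, ite_mul]
  simp [mul_assoc]

theorem pair_mul (hc : IsCAR c) (i k j : ι) : c i * c k * c j = c j * (c i * c k) := by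
  rw [mul_assoc, hc.anti k, mul_neg, ← mul_assoc, hc.anti i, neg_mul, neg_neg, mul_assoc]

theorem star_pair_mul (hc : IsCAR c) (i k j : ι) :
    star (c i) * star (c k) * c j = c j * (star (c i) * star (c k))
      + (if k = j then star (c i) else 0) - if i = j then star (c k) else 0 := by
  rw [mul_assoc, hc.star_mul k, mul_sub, ← mul_assoc, hc.star_mul i, sub_mul]
  simp only [mul_ite, ite_mul, mul_one, one_mul, mul_zero, zero_mul, mul_assoc]
  abel

theorem number_mul_star (hc : IsCAR c) (i j : ι) :
    star (c i) * c i * star (c j) = star (c j) * (star (c i) * c i)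
      + if i = j then star (c i) else 0 := by
  rw [mul_assoc, hc.anti_star, mul_sub, ← mul_assoc, hc.star_anti i, neg_mul, mul_assoc]
  simp only [mul_ite, mul_one, mul_zero]
  abel

theorem number_commute (hc : IsCAR c) (i j : ι) :
    Commute (star (c i) * c i) (star (c j) * c j) := by
  rw [Commute, SemiconjBy, ← mul_assoc (star (c i) * c i), hc.number_mul_star, add_mul,
    mul_assoc (star (c j)), hc.number_mul, mul_sub, mul_assoc (star (c j)) (c j)]
  rcases eq_or_ne i j with rfl | h
  · simp
  · simp [h]

theorem sq_eq_zero [Algebra ℂ R] (hc : IsCAR c) (i : ι) : c i * c i = 0 := by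
  have h : (2 : ℂ) • (c i * c i) = 0 := by
    rw [two_smul]
    nth_rewrite 1 [hc.anti]
    simp
  exact (smul_eq_zero_iff_right two_ne_zero).1 h

theorem number_idem [Algebra ℂ R] (hc : IsCAR c) (i : ι) :
    IsIdempotentElem (star (c i) * c i) := by
  rw [IsIdempotentElem, ← mul_assoc, hc.number_mul_star, if_pos rfl, add_mul, mul_assoc,
    mul_assoc (star (c i)) (c i) (c i), hc.sq_eq_zero]
  simp

end IsCAR

/-! ### Energy lowering (Bogoliubov) operators -/

section Commutators

variable [NeZero L] {R : Type*} [Ring R] [StarRing R] [Algebra ℂ R] [StarModule ℂ R]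
  {c : Fin L → R}

theorem isCAR_mode (hc : IsCAR c) : IsCAR (mode c : Momentum L b → R) where
  anti z w := by
    simp only [mode, sum_smul_mul_sum_smul]
    rw [Finset.sum_comm, ← Finset.sum_neg_distrib]
    refine Finset.sum_congr rfl fun i _ => ?_
    rw [← Finset.sum_neg_distrib]
    refine Finset.sum_congr rfl fun j _ => ?_
    rw [hc.anti, smul_neg, mul_comm]
  anti_star z w := by
    rw [star_mode, mode, sum_smul_mul_sum_smul, sum_smul_mul_sum_smul, eq_sub_iff_add_eq]
    nth_rewrite 2 [Finset.sum_comm]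
    rw [← Finset.sum_add_distrib]
    simp only [← Finset.sum_add_distrib]
    have h : ∀ i j, (wave z i * star (wave w j)) • (c i * star (c j))
        + (star (wave w j) * wave z i) • (star (c j) * c i)
        = if i = j then (wave z i * star (wave w j)) • (1 : R) else 0 := by
      intro i j
      rw [mul_comm (star (wave w j)), ← smul_add, hc.anti_star, sub_add_cancel, smul_ite, smul_zero]
    simp only [h, Finset.sum_ite_eq, Finset.mem_univ, if_true]
    rw [← Finset.sum_smul, sum_wave_mul_star, ite_smul, one_smul, zero_smul]

/-- The commutator of a quadratic with a linear expression is linear. The pairing terms of `z` and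
of `-z` both contribute; together they give `z - star z`, hence the sine. -/
theorem kitaev_mul_mode (hc : IsCAR c) (t Δ μ : ℝ) (z : Momentum L b) :
    kitaev b c t Δ μ * mode c z = mode c z * kitaev b c t Δ μ
      + ((t * (z : ℂ).re + μ : ℝ) : ℂ) • mode c z
      - (Complex.I * (Δ * (z : ℂ).im : ℝ)) • star (mode c z.neg) := by
  have hA := isCAR_mode (b := b) hc
  have hz : Complex.I * (Δ * (z : ℂ).im : ℝ) = (Δ : ℂ) / 2 * z - (Δ : ℂ) / 2 * star (z : ℂ) := by
    have : (z : ℂ) - star (z : ℂ) = (2 * (z : ℂ).im : ℝ) * Complex.I := Complex.sub_conj (z : ℂ)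
    rw [← mul_sub, this]
    push_cast
    ring
  rw [kitaev_eq_sum_mode]
  simp only [add_mul, mul_add, Finset.sum_mul, Finset.mul_sum, smul_mul_assoc, mul_smul_comm,
    hA.number_mul, hA.pair_mul, hA.star_pair_mul, one_mul, mul_one, smul_add, smul_sub,
    Finset.sum_add_distrib, Finset.sum_sub_distrib, smul_ite, smul_zero, Finset.sum_ite_eq',
    Momentum.neg_eq_iff, Finset.mem_univ, if_true, Momentum.coe_neg, smul_smul]
  rw [hz]
  module

theorem kitaev_mul_star_mode (hc : IsCAR c) (t Δ μ : ℝ) (z : Momentum L b) :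
    kitaev b c t Δ μ * star (mode c z) = star (mode c z) * kitaev b c t Δ μ
      - ((t * (z : ℂ).re + μ : ℝ) : ℂ) • star (mode c z)
      - (Complex.I * (Δ * (z : ℂ).im : ℝ)) • mode c z.neg := by
  have h := congrArg star (kitaev_mul_mode hc t Δ μ z)
  simp only [star_mul, star_add, star_sub, star_smul, star_star, kitaev_isSelfAdjoint] at h
  rw [h]
  simp only [Complex.star_def, Complex.conj_I, Complex.conj_ofReal]
  module

/-- The excitation energy of a momentum mode. -/
def Momentum.energy (t Δ μ : ℝ) (z : Momentum L b) : ℝ :=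
  √((t * (z : ℂ).re + μ) ^ 2 + (Δ * (z : ℂ).im) ^ 2)

theorem Momentum.energy_sq (t Δ μ : ℝ) (z : Momentum L b) :
    z.energy t Δ μ ^ 2 = (t * (z : ℂ).re + μ) ^ 2 + (Δ * (z : ℂ).im) ^ 2 :=
  Real.sq_sqrt (by positivity)

/-- The combination of `c_k` and `c_{-k}†` that lowers the energy by `E_k`, proportional to the
Bogoliubov annihilation operator. -/
def lowering (t Δ μ : ℝ) (c : Fin L → R) (z : Momentum L b) : R :=
  ((z.energy t Δ μ - (t * (z : ℂ).re + μ) : ℝ) : ℂ) • mode c z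
    + (Complex.I * (Δ * (z : ℂ).im : ℝ)) • star (mode c z.neg)

/-- The combination of `c_k†` and `c_{-k}` that lowers the energy by `E_k`. -/
def loweringStar (t Δ μ : ℝ) (c : Fin L → R) (z : Momentum L b) : R :=
  ((z.energy t Δ μ + (t * (z : ℂ).re + μ) : ℝ) : ℂ) • star (mode c z)
    + (Complex.I * (Δ * (z : ℂ).im : ℝ)) • mode c z.neg

/-- The commutator acts on the span of `c_k` and `c_{-k}†` as a 2 × 2 matrix with eigenvalues
`±E_k`; the coefficients of `lowering` form an eigenvector for `-E_k`, by `E_k² = ξ² + s²`. -/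
theorem kitaev_mul_lowering (hc : IsCAR c) (t Δ μ : ℝ) (z : Momentum L b) :
    kitaev b c t Δ μ * lowering t Δ μ c z
      = lowering t Δ μ c z * kitaev b c t Δ μ - (z.energy t Δ μ : ℂ) • lowering t Δ μ c z := by
  have hE : (z.energy t Δ μ : ℂ) * z.energy t Δ μ
      = ((t * (z : ℂ).re + μ : ℝ) : ℂ) ^ 2 + ((Δ * (z : ℂ).im : ℝ) : ℂ) ^ 2 := by
    rw [← sq]
    exact_mod_cast z.energy_sq t Δ μ
  have hre : (z.neg : ℂ).re = (z : ℂ).re := by simp [Momentum.coe_neg]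
  have him : (z.neg : ℂ).im = -(z : ℂ).im := by simp [Momentum.coe_neg]
  simp only [lowering, mul_add, add_mul, mul_smul_comm, smul_mul_assoc, kitaev_mul_mode hc,
    kitaev_mul_star_mode hc, Momentum.neg_neg, hre, him]
  have h1 := congrArg (fun x : ℂ => x • mode c z) hE
  have hI := congrArg (fun x : ℂ => (x * ((Δ * (z : ℂ).im : ℝ) : ℂ) ^ 2) • mode c z)
    Complex.I_mul_I
  push_cast at h1 hI ⊢
  linear_combination (norm := module) h1 + hI

/-- This second family matters at `z = ±1`: the pairing vanishes there and, if `ξ > 0`, so does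
`lowering`, while `loweringStar` is `2ξ c_k†`. -/
theorem kitaev_mul_loweringStar (hc : IsCAR c) (t Δ μ : ℝ) (z : Momentum L b) :
    kitaev b c t Δ μ * loweringStar t Δ μ c z
      = loweringStar t Δ μ c z * kitaev b c t Δ μ
        - (z.energy t Δ μ : ℂ) • loweringStar t Δ μ c z := by
  have hE : (z.energy t Δ μ : ℂ) * z.energy t Δ μ
      = ((t * (z : ℂ).re + μ : ℝ) : ℂ) ^ 2 + ((Δ * (z : ℂ).im : ℝ) : ℂ) ^ 2 := by
    rw [← sq]
    exact_mod_cast z.energy_sq t Δ μ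
  have hre : (z.neg : ℂ).re = (z : ℂ).re := by simp [Momentum.coe_neg]
  have him : (z.neg : ℂ).im = -(z : ℂ).im := by simp [Momentum.coe_neg]
  simp only [loweringStar, mul_add, add_mul, mul_smul_comm, smul_mul_assoc, kitaev_mul_mode hc,
    kitaev_mul_star_mode hc, Momentum.neg_neg, hre, him]
  have h1 := congrArg (fun x : ℂ => x • star (mode c z)) hE
  have hI := congrArg (fun x : ℂ => (x * ((Δ * (z : ℂ).im : ℝ) : ℂ) ^ 2) • star (mode c z))
    Complex.I_mul_I
  push_cast at h1 hI ⊢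
  linear_combination (norm := module) h1 + hI

end Commutators

/-! ### Occupation numbers in the vacuum -/

section Vacuum

variable [NeZero L] {V : Type*} [NormedAddCommGroup V] [InnerProductSpace ℂ V]
  [FiniteDimensional ℂ V] {c : Fin L → Module.End ℂ V} {t Δ μ : ℝ} {ψ : V}

/-- The occupation number of a momentum mode. -/
def modeNumber (c : Fin L → Module.End ℂ V) (z : Momentum L b) : Module.End ℂ V :=
  star (mode c z) * mode c z

/-- The states that are annihilated by all energy lowering operators. -/
def IsVacuum (b : Boundary) (c : Fin L → Module.End ℂ V) (t Δ μ : ℝ) (ψ : V) : Prop :=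
  ∀ z : Momentum L b, lowering t Δ μ c z ψ = 0 ∧ loweringStar t Δ μ c z ψ = 0

theorem Momentum.neg_eq_self_of_im_eq_zero {z : Momentum L b} (h : (z : ℂ).im = 0) :
    z.neg = z :=
  Subtype.ext (Complex.conj_eq_iff_im.2 h)

theorem Momentum.re_neg (z : Momentum L b) : (z.neg : ℂ).re = (z : ℂ).re := by
  simp [Momentum.coe_neg]

theorem Momentum.im_neg (z : Momentum L b) : (z.neg : ℂ).im = -(z : ℂ).im := by
  simp [Momentum.coe_neg]

theorem Momentum.energy_neg (z : Momentum L b) : z.neg.energy t Δ μ = z.energy t Δ μ := by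
  rw [Momentum.energy, Momentum.energy, Momentum.re_neg, Momentum.im_neg, mul_neg, neg_sq]

theorem Momentum.lt_energy (hΔ : Δ ≠ 0) {z : Momentum L b} (hz : (z : ℂ).im ≠ 0) :
    t * (z : ℂ).re + μ < z.energy t Δ μ := by
  refine Real.lt_sqrt_of_sq_lt ?_
  have : 0 < (Δ * (z : ℂ).im) ^ 2 := by positivity
  linarith

theorem Momentum.energy_of_im_eq_zero {z : Momentum L b} (hz : (z : ℂ).im = 0) :
    z.energy t Δ μ = |t * (z : ℂ).re + μ| := by
  rw [Momentum.energy, hz, mul_zero, zero_pow two_ne_zero, add_zero, Real.sqrt_sq_eq_abs]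

/-- Applying `c_k†` to the vacuum equation of `k`, and `c_{-k}†` to that of `-k`, produces the same
pair term: the sign of the sine cancels the sign of the anticommutation. The difference is `(E_k -
ξ)(n_{-k} - n_k) ψ = 0`, with `E_k > ξ`. -/
theorem IsVacuum.modeNumber_neg (hc : IsCAR c) (hψ : IsVacuum b c t Δ μ ψ) (hΔ : Δ ≠ 0)
    (z : Momentum L b) : modeNumber c z.neg ψ = modeNumber c z ψ := by
  by_cases hz : (z : ℂ).im = 0
  · rw [Momentum.neg_eq_self_of_im_eq_zero hz]
  have h1 := congrArg (fun x => star (mode c z) x) (hψ z).1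
  have h2 := congrArg (fun x => star (mode c z.neg) x) (hψ z.neg).1
  have h3 : star (mode c z.neg) (star (mode c z) ψ) = -star (mode c z) (star (mode c z.neg) ψ) := by
    have := congrArg (fun T : Module.End ℂ V => T ψ)
      ((isCAR_mode (b := b) hc).star_anti z.neg z)
    simpa using this
  simp only [lowering, Momentum.energy_neg, Momentum.re_neg, Momentum.im_neg, Momentum.neg_neg,
    LinearMap.add_apply, LinearMap.smul_apply, map_add, map_smul, map_zero, h3] at h1 h2
  have hpos := sub_pos.2 (Momentum.lt_energy (t := t) (μ := μ) hΔ hz)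
  have h4 : ((z.energy t Δ μ - (t * (z : ℂ).re + μ) : ℝ) : ℂ)
      • (modeNumber c z.neg ψ - modeNumber c z ψ) = 0 := by
    simp only [modeNumber, Module.End.mul_apply]
    push_cast at h1 h2 ⊢
    linear_combination (norm := module) h2 - h1
  rw [smul_eq_zero_iff_right (by exact_mod_cast hpos.ne')] at h4
  exact sub_eq_zero.1 h4

theorem IsVacuum.modeNumber_eq_self (hc : IsCAR c) (hψ : IsVacuum b c t Δ μ ψ)
    {z : Momentum L b} (hz : (z : ℂ).im = 0) (hξ : 0 < t * (z : ℂ).re + μ) :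
    modeNumber c z ψ = ψ := by
  have h := (hψ z).2
  rw [loweringStar, Momentum.energy_of_im_eq_zero hz, abs_of_pos hξ, hz] at h
  simp only [mul_zero, Complex.ofReal_zero, zero_smul, add_zero, LinearMap.smul_apply] at h
  rw [smul_eq_zero_iff_right (by exact_mod_cast (by linarith : 0 <
    t * (z : ℂ).re + μ + (t * (z : ℂ).re + μ)).ne')] at h
  have h2 := congrArg (fun T : Module.End ℂ V => T ψ)
      ((isCAR_mode (b := b) hc).star_mul z z)
  simp only [if_pos, LinearMap.sub_apply, Module.End.mul_apply, Module.End.one_apply, h, map_zero,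
    sub_zero] at h2
  exact h2

theorem IsVacuum.modeNumber_eq_zero (hψ : IsVacuum b c t Δ μ ψ)
    {z : Momentum L b} (hz : (z : ℂ).im = 0) (hξ : t * (z : ℂ).re + μ < 0) :
    modeNumber c z ψ = 0 := by
  have h := (hψ z).1
  rw [lowering, Momentum.energy_of_im_eq_zero hz, abs_of_neg hξ, hz] at h
  simp only [mul_zero, Complex.ofReal_zero, zero_smul, add_zero, LinearMap.smul_apply] at h
  rw [smul_eq_zero_iff_right (by exact_mod_cast (by linarith : 0 <
    -(t * (z : ℂ).re + μ) - (t * (z : ℂ).re + μ)).ne')] at h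
  rw [modeNumber, Module.End.mul_apply, h, map_zero]

theorem Momentum.coe_eq_one_or_of_im_eq_zero {z : Momentum L b} (hz : (z : ℂ).im = 0) :
    (z : ℂ) = 1 ∨ (z : ℂ) = -1 := by
  have h : star (z : ℂ) = z := Complex.conj_eq_iff_im.2 hz
  have h2 := z.star_mul_self
  rw [h] at h2
  exact mul_self_eq_one_iff.1 h2

/-- In the range `|μ| < t` the band is positive at `k = 0` and negative at `k = π`. -/
theorem band_ne_zero (hμ : |μ| < t) {z : Momentum L b} (hz : (z : ℂ).im = 0) :
    t * (z : ℂ).re + μ ≠ 0 := by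
  rw [abs_lt] at hμ
  rcases z.coe_eq_one_or_of_im_eq_zero hz with h | h <;> rw [h] <;> simp <;> intro h' <;> linarith

/-- The mean occupation of a momentum mode in the vacuum. -/
def Momentum.occupation (t Δ μ : ℝ) (z : Momentum L b) : ℝ :=
  (1 + (t * (z : ℂ).re + μ) / z.energy t Δ μ) / 2

theorem inner_star_apply (T : Module.End ℂ V) (x y : V) : ⟪star T x, y⟫_ℂ = ⟪x, T y⟫_ℂ := by
  rw [LinearMap.star_eq_adjoint, LinearMap.adjoint_inner_left]

theorem inner_star_apply_right (T : Module.End ℂ V) (x y : V) :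
    ⟪x, star T y⟫_ℂ = ⟪T x, y⟫_ℂ := by
  rw [LinearMap.star_eq_adjoint, LinearMap.adjoint_inner_right]

/-- The vacuum equation reads `(E - ξ) c_k ψ = -i s c_{-k}† ψ`. Taking the expectation of `Y` on
both sides, with `n_{-k} ψ = n_k ψ`, gives `(E - ξ)² ⟨Y n_k⟩ = s² (⟨Y⟩ - ⟨Y n_k⟩)`, and `s² = (E -
ξ)(E + ξ)` leaves `⟨Y n_k⟩ = (E + ξ)/(2E) ⟨Y⟩`. `Y = 1` gives the mean occupation, and `Y = n_w` for
another pair gives independence; no Wick theorem is needed. -/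
theorem IsVacuum.inner_mul_modeNumber (hc : IsCAR c) (hψ : IsVacuum b c t Δ μ ψ) (hΔ : Δ ≠ 0)
    (hμ : |μ| < t) (z : Momentum L b) (Y : Module.End ℂ V)
    (h1 : Commute (star (mode c z)) Y) (h2 : Commute (mode c z.neg) Y) :
    ⟪ψ, Y (modeNumber c z ψ)⟫_ℂ = z.occupation t Δ μ * ⟪ψ, Y ψ⟫_ℂ := by
  by_cases hz : (z : ℂ).im = 0
  · rcases (band_ne_zero hμ hz).lt_or_gt with h | h
    · rw [hψ.modeNumber_eq_zero hz h, Momentum.occupation, Momentum.energy_of_im_eq_zero hz,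
        abs_of_neg h, div_neg, div_self h.ne]
      simp
    · rw [hψ.modeNumber_eq_self hc hz h, Momentum.occupation, Momentum.energy_of_im_eq_zero hz,
        abs_of_pos h, div_self h.ne']
      norm_num
  have hlt := Momentum.lt_energy (t := t) (μ := μ) hΔ hz
  have hE : 0 < z.energy t Δ μ := Real.sqrt_pos.2 (by positivity)
  have hsq := z.energy_sq t Δ μ
  have h := (hψ z).1
  rw [lowering, LinearMap.add_apply, LinearMap.smul_apply, LinearMap.smul_apply] at h
  have hA : ∀ T : Module.End ℂ V, Commute (star T) Y →
      ⟪T ψ, Y (T ψ)⟫_ℂ = ⟪ψ, Y (star T (T ψ))⟫_ℂ := by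
    intro T hT
    rw [← inner_star_apply_right, ← Module.End.mul_apply (star T) Y, hT.eq, Module.End.mul_apply]
  have hx := hA (mode c z) h1
  have hy := hA (star (mode c z.neg)) (by rwa [star_star])
  have hcar := congrArg (fun T : Module.End ℂ V => T ψ)
      ((isCAR_mode (b := b) hc).anti_star z.neg z.neg)
  simp only [if_pos, LinearMap.sub_apply, Module.End.mul_apply, Module.End.one_apply] at hcar
  have hn := hψ.modeNumber_neg hc hΔ z
  rw [modeNumber, Module.End.mul_apply] at hn
  rw [star_star, hcar, hn, map_sub, inner_sub_right] at hy
  rw [← Module.End.mul_apply (star (mode c z)), ← modeNumber] at hx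
  set e : ℝ := z.energy t Δ μ
  set ξ : ℝ := t * (z : ℂ).re + μ
  set s : ℝ := Δ * (z : ℂ).im
  have hk : ((e - ξ : ℝ) : ℂ) • mode c z ψ = -((Complex.I * (s : ℂ)) • star (mode c z.neg) ψ) :=
    eq_neg_of_add_eq_zero_left h
  have key : ((e - ξ : ℝ) : ℂ) ^ 2 * ⟪mode c z ψ, Y (mode c z ψ)⟫_ℂ
      = (s : ℂ) ^ 2 * ⟪star (mode c z.neg) ψ, Y (star (mode c z.neg) ψ)⟫_ℂ := by
    have h3 : ⟪((e - ξ : ℝ) : ℂ) • mode c z ψ, Y (((e - ξ : ℝ) : ℂ) • mode c z ψ)⟫_ℂ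
        = ⟪-((Complex.I * (s : ℂ)) • star (mode c z.neg) ψ),
            Y (-((Complex.I * (s : ℂ)) • star (mode c z.neg) ψ))⟫_ℂ := by rw [hk]
    simp only [map_smul, map_neg, inner_smul_left, inner_smul_right, inner_neg_left,
      inner_neg_right, map_mul, Complex.conj_I, Complex.conj_ofReal] at h3
    linear_combination h3 - (s : ℂ) ^ 2 *
      ⟪star (mode c z.neg) ψ, Y (star (mode c z.neg) ψ)⟫_ℂ * Complex.I_mul_I
  rw [hx, hy] at key
  have hs : (s : ℂ) ^ 2 = ((e - ξ : ℝ) : ℂ) * ((e + ξ : ℝ) : ℂ) := by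
    have : s ^ 2 = (e - ξ) * (e + ξ) := by linear_combination -hsq
    exact_mod_cast this
  rw [hs, sq, mul_assoc, mul_assoc] at key
  have h0 : ((e - ξ : ℝ) : ℂ) ≠ 0 := by exact_mod_cast (sub_pos.2 hlt).ne'
  have key2 := mul_left_cancel₀ h0 key
  have he : (e : ℂ) ≠ 0 := by exact_mod_cast hE.ne'
  have hocc : ((z.occupation t Δ μ : ℝ) : ℂ) = ((1 + (ξ : ℂ) / e) / 2) := by
    change (((1 + ξ / e) / 2 : ℝ) : ℂ) = _
    push_cast
    rfl
  rw [hocc]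
  push_cast at key2
  field_simp
  linear_combination key2

theorem IsVacuum.inner_modeNumber (hc : IsCAR c) (hψ : IsVacuum b c t Δ μ ψ) (hΔ : Δ ≠ 0)
    (hμ : |μ| < t) (hn : ‖ψ‖ = 1) (z : Momentum L b) :
    ⟪ψ, modeNumber c z ψ⟫_ℂ = z.occupation t Δ μ := by
  have h := hψ.inner_mul_modeNumber hc hΔ hμ z 1 (Commute.one_right _) (Commute.one_right _)
  simpa [hn] using h

theorem IsVacuum.inner_modeNumber_mul (hc : IsCAR c) (hψ : IsVacuum b c t Δ μ ψ) (hΔ : Δ ≠ 0)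
    (hμ : |μ| < t) (hn : ‖ψ‖ = 1) (z w : Momentum L b) :
    ⟪ψ, modeNumber c w (modeNumber c z ψ)⟫_ℂ
      = if w = z ∨ w = z.neg then z.occupation t Δ μ
        else w.occupation t Δ μ * z.occupation t Δ μ := by
  have hA := isCAR_mode (b := b) hc
  have hid : modeNumber c z (modeNumber c z ψ) = modeNumber c z ψ := by
    rw [← Module.End.mul_apply]
    exact congrArg (fun T : Module.End ℂ V => T ψ) (hA.number_idem z)
  split_ifs with h
  · rcases h with rfl | rfl
    · rw [hid, hψ.inner_modeNumber hc hΔ hμ hn]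
    · have hcomm : modeNumber c z.neg (modeNumber c z ψ)
          = modeNumber c z (modeNumber c z.neg ψ) := by
        rw [← Module.End.mul_apply, ← Module.End.mul_apply]
        exact congrArg (fun T : Module.End ℂ V => T ψ) (hA.number_commute z.neg z).eq
      rw [hcomm, hψ.modeNumber_neg hc hΔ, hid, hψ.inner_modeNumber hc hΔ hμ hn]
  · push Not at h
    rw [hψ.inner_mul_modeNumber hc hΔ hμ, hψ.inner_modeNumber hc hΔ hμ hn, Complex.ofReal_mul,
      mul_comm]
    · change star (mode c z) * (star (mode c w) * mode c w) = _
      rw [modeNumber, hA.number_mul_star, if_neg h.1, add_zero]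
    · change mode c z.neg * (star (mode c w) * mode c w) = _
      rw [modeNumber, hA.number_mul, if_neg h.2, sub_zero]

/-- The particle number of the wire. -/
def siteNumber (c : Fin L → Module.End ℂ V) : Module.End ℂ V := ∑ j, star (c j) * c j

theorem siteNumber_eq_sum_modeNumber (b : Boundary) (c : Fin L → Module.End ℂ V) :
    siteNumber c = ∑ z : Momentum L b, modeNumber c z :=
  (sum_star_mode_mul_mode c).symm

/-- The mean particle number in the vacuum. -/
def meanNumber (L : ℕ) (b : Boundary) (t Δ μ : ℝ) : ℝ :=
  ∑ z : Momentum L b, z.occupation t Δ μ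

theorem IsVacuum.inner_siteNumber (hc : IsCAR c) (hψ : IsVacuum b c t Δ μ ψ) (hΔ : Δ ≠ 0)
    (hμ : |μ| < t) (hn : ‖ψ‖ = 1) : ⟪ψ, siteNumber c ψ⟫_ℂ = meanNumber L b t Δ μ := by
  rw [siteNumber_eq_sum_modeNumber b, LinearMap.sum_apply, inner_sum, meanNumber,
    Complex.ofReal_sum]
  exact Finset.sum_congr rfl fun z _ => hψ.inner_modeNumber hc hΔ hμ hn z

theorem IsVacuum.inner_siteNumber_sq_le (hc : IsCAR c) (hψ : IsVacuum b c t Δ μ ψ) (hΔ : Δ ≠ 0)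
    (hμ : |μ| < t) (hn : ‖ψ‖ = 1) :
    (⟪ψ, siteNumber c (siteNumber c ψ)⟫_ℂ).re ≤ meanNumber L b t Δ μ ^ 2 + L / 2 := by
  have h1 : ⟪ψ, siteNumber c (siteNumber c ψ)⟫_ℂ = ((∑ w : Momentum L b, ∑ z : Momentum L b,
      if w = z ∨ w = z.neg then z.occupation t Δ μ
        else w.occupation t Δ μ * z.occupation t Δ μ : ℝ) : ℂ) := by
    rw [siteNumber_eq_sum_modeNumber b, LinearMap.sum_apply, inner_sum]
    simp only [LinearMap.sum_apply, map_sum, inner_sum, hψ.inner_modeNumber_mul hc hΔ hμ hn]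
    push_cast
    rfl
  have hocc : ∀ z : Momentum L b, z.neg.occupation t Δ μ = z.occupation t Δ μ := by
    intro z
    rw [Momentum.occupation, Momentum.occupation, Momentum.energy_neg, Momentum.re_neg]
  -- Only `z = w` and `z = -w` are correlated with `w`, each with covariance `p - p² ≤ 1/4`. Summed
  -- over the `L` momenta `w` this bounds the variance by `L/2`.
  have h2 : ∀ w z : Momentum L b, (if w = z ∨ w = z.neg then z.occupation t Δ μ
        else w.occupation t Δ μ * z.occupation t Δ μ)
      ≤ w.occupation t Δ μ * z.occupation t Δ μ
        + ((if w = z then 1 / 4 else 0) + if w.neg = z then 1 / 4 else 0) := by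
    intro w z
    have hq : ∀ x : ℝ, x ≤ x * x + 1 / 4 := fun x => by nlinarith [sq_nonneg (x - 1 / 2)]
    simp only [Momentum.neg_eq_iff]
    rcases eq_or_ne w z with h | h
    · subst h
      have := hq (w.occupation t Δ μ)
      simp only [true_or, if_true]
      split_ifs <;> linarith
    · rcases eq_or_ne w z.neg with h' | h'
      · subst h'
        have := hq (z.occupation t Δ μ)
        simp only [or_true, if_true, hocc]
        split_ifs <;> linarith
      · simp [h, h']
  rw [h1, Complex.ofReal_re, meanNumber, sq, Finset.sum_mul_sum]
  refine (Finset.sum_le_sum fun w _ => Finset.sum_le_sum fun z _ => h2 w z).trans ?_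
  simp only [Finset.sum_add_distrib, Finset.sum_ite_eq, Finset.mem_univ, if_true, Finset.sum_const,
    Finset.card_univ, Momentum.card, nsmul_eq_mul]
  linarith

end Vacuum

/-! ### Fermion parity of the vacuum -/

/-- Apply the projections one after another, skipping those that kill the current vector;
commutativity keeps the eigenvalues already obtained. `P` carries along the properties that the
projected vector must inherit. -/
theorem exists_joint_eigenvector {V ι : Type*} [AddCommGroup V] [Module ℂ V] [Fintype ι]
    (n : ι → Module.End ℂ V) (hid : ∀ i, IsIdempotentElem (n i))
    (hcomm : ∀ i j, Commute (n i) (n j)) (P : V → Prop) (hP : ∀ φ i, P φ → P (n i φ))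
    (ψ : V) (hψ : P ψ) (h0 : ψ ≠ 0) :
    ∃ φ, P φ ∧ φ ≠ 0 ∧ ∀ i, n i φ = 0 ∨ n i φ = φ := by
  classical
  suffices h : ∀ s : Finset ι, ∃ φ, P φ ∧ φ ≠ 0 ∧ ∀ i ∈ s, n i φ = 0 ∨ n i φ = φ by
    obtain ⟨φ, h1, h2, h3⟩ := h Finset.univ
    exact ⟨φ, h1, h2, fun i => h3 i (Finset.mem_univ i)⟩
  intro s
  induction s using Finset.induction_on with
  | empty => exact ⟨ψ, hψ, h0, by simp⟩
  | insert i s _ ih =>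
    obtain ⟨φ, h1, h2, h3⟩ := ih
    have hii : n i (n i φ) = n i φ := by
      rw [← Module.End.mul_apply, (hid i).eq]
    have hij : ∀ j, n j (n i φ) = n i (n j φ) := by
      intro j
      rw [← Module.End.mul_apply, (hcomm j i).eq, Module.End.mul_apply]
    by_cases h : n i φ = 0
    · refine ⟨φ, h1, h2, fun j hj => ?_⟩
      rcases Finset.mem_insert.1 hj with rfl | hj
      · exact Or.inl h
      · exact h3 j hj
    · refine ⟨n i φ, hP φ i h1, h, fun j hj => ?_⟩
      rcases Finset.mem_insert.1 hj with rfl | hj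
      · exact Or.inr hii
      · rw [hij]
        rcases h3 j hj with h4 | h4
        · rw [h4, map_zero]; exact Or.inl rfl
        · rw [h4]; exact Or.inr rfl

/-- The states of given fermion parity. -/
def paritySubspace (L : ℕ) (ε : ZMod 2) : Submodule ℂ (Fock L) where
  carrier := {φ | ∀ S : Finset (Fin L), (S.card : ZMod 2) ≠ ε → φ S = 0}
  zero_mem' := fun _ _ => rfl
  add_mem' := fun {φ χ} hφ hχ S hS => by
    rw [PiLp.add_apply, hφ S hS, hχ S hS, add_zero]
  smul_mem' := fun a φ hφ S hS => by
    rw [PiLp.smul_apply, hφ S hS, smul_zero]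

theorem siteAnnih_mem {ε : ZMod 2} {φ : Fock L} (hφ : φ ∈ paritySubspace L ε) (j : Fin L) :
    siteAnnih j φ ∈ paritySubspace L (ε + 1) := by
  intro S hS
  rw [siteAnnih_apply]
  split_ifs with h
  · rfl
  · rw [hφ, mul_zero]
    rw [Finset.card_insert_of_notMem h, Nat.cast_add, Nat.cast_one]
    intro h'
    apply hS
    rw [← h', add_assoc, CharTwo.add_self_eq_zero, add_zero]

theorem star_siteAnnih_mem {ε : ZMod 2} {φ : Fock L} (hφ : φ ∈ paritySubspace L ε) (j : Fin L) :
    star (siteAnnih j) φ ∈ paritySubspace L (ε + 1) := by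
  intro S hS
  rw [star_siteAnnih, siteCreate_apply]
  split_ifs with h
  · rw [hφ, mul_zero]
    intro h'
    apply hS
    rw [← h', ← Finset.card_erase_add_one h, Nat.cast_add, Nat.cast_one]
  · rfl

theorem mode_siteAnnih_mem {ε : ZMod 2} {φ : Fock L} (hφ : φ ∈ paritySubspace L ε)
    (z : Momentum L b) : mode siteAnnih z φ ∈ paritySubspace L (ε + 1) := by
  rw [mode, LinearMap.sum_apply]
  exact Submodule.sum_mem _ fun j _ => Submodule.smul_mem _ _ (siteAnnih_mem hφ j)

theorem star_mode_siteAnnih_mem {ε : ZMod 2} {φ : Fock L} (hφ : φ ∈ paritySubspace L ε)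
    (z : Momentum L b) : star (mode siteAnnih z) φ ∈ paritySubspace L (ε + 1) := by
  rw [star_mode, LinearMap.sum_apply]
  exact Submodule.sum_mem _ fun j _ => Submodule.smul_mem _ _ (star_siteAnnih_mem hφ j)

theorem add_one_add_one (ε : ZMod 2) : ε + 1 + 1 = ε := by
  rw [add_assoc, CharTwo.add_self_eq_zero, add_zero]

theorem modeNumber_mem [NeZero L] {ε : ZMod 2} {φ : Fock L} (hφ : φ ∈ paritySubspace L ε)
    (z : Momentum L b) : modeNumber siteAnnih z φ ∈ paritySubspace L ε := by
  rw [← add_one_add_one ε]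
  exact star_mode_siteAnnih_mem (mode_siteAnnih_mem hφ z) z

theorem siteNumber_apply (φ : Fock L) (S : Finset (Fin L)) :
    siteNumber siteAnnih φ S = (S.card : ℂ) * φ S := by
  have h : ∀ j : Fin L, (star (siteAnnih j) * siteAnnih j) φ S = if j ∈ S then φ S else 0 := by
    intro j
    rw [star_siteAnnih, Module.End.mul_apply, siteCreate_apply, siteAnnih_apply]
    split_ifs with h1 h2
    · simp at h2
    · rw [Finset.insert_erase h1, jwSign_erase_of_le _ le_rfl, ← mul_assoc, jwSign_mul_self,
        one_mul]
    · rfl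
  rw [siteNumber, LinearMap.sum_apply, WithLp.ofLp_sum, Finset.sum_apply]
  simp only [h, Finset.sum_ite_mem, Finset.univ_inter, Finset.sum_const, nsmul_eq_mul]

/-- The fermion parity of the ground state. -/
def Boundary.groundParity : Boundary → ZMod 2
  | .periodic => 1
  | .antiperiodic => 0

theorem Momentum.sum_ite_eq_one [NeZero L] (b : Boundary) :
    (∑ z : Momentum L b, if (z : ℂ) = 1 then (1 : ZMod 2) else 0) = b.groundParity := by
  cases b
  · have h1 : (1 : ℂ) ∈ Polynomial.nthRootsFinset L Boundary.periodic.sign := by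
      rw [Polynomial.mem_nthRootsFinset (NeZero.pos L), one_pow]
      rfl
    have h2 : ∀ z : Momentum L .periodic, (z : ℂ) = 1 ↔ z = ⟨1, h1⟩ := fun z => by
      rw [Subtype.ext_iff]
    simp only [h2, Finset.sum_ite_eq', Finset.mem_univ, if_true]
    rfl
  · refine Finset.sum_eq_zero fun z _ => if_neg fun h => ?_
    have := z.pow_eq
    rw [h, one_pow, Boundary.sign] at this
    norm_num at this

/-- The vacuum need not have a definite particle number, but projecting it onto joint eigenspaces of
the mode numbers keeps its parity and its occupation pattern. Modulo 2 the modes `k` and `-k`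
cancel, `z = -1` is empty, and the count is 1 exactly when `z = 1` is a momentum of the ring. -/
theorem IsVacuum.parity_eq [NeZero L] {t Δ μ : ℝ} {ψ : Fock L}
    (hψ : IsVacuum b siteAnnih t Δ μ ψ) (hΔ : Δ ≠ 0) (hμ : |μ| < t) (h0 : ψ ≠ 0) {ε : ZMod 2}
    (hε : ψ ∈ paritySubspace L ε) : ε = b.groundParity := by
  have hA := isCAR_mode (b := b) (isCAR_siteAnnih (L := L))
  have hcomm : ∀ z w : Momentum L b, Commute (modeNumber siteAnnih z) (modeNumber siteAnnih w) :=
    hA.number_commute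
  have hc' : ∀ (z w : Momentum L b) (φ : Fock L), modeNumber siteAnnih z (modeNumber siteAnnih w φ)
      = modeNumber siteAnnih w (modeNumber siteAnnih z φ) := by
    intro z w φ
    rw [← Module.End.mul_apply, (hcomm z w).eq, Module.End.mul_apply]
  obtain ⟨φ, ⟨h1, h2, h3, h4⟩, h5, h6⟩ := exists_joint_eigenvector
    (modeNumber siteAnnih : Momentum L b → Module.End ℂ (Fock L)) hA.number_idem hcomm
    (fun φ => φ ∈ paritySubspace L ε ∧
      (∀ z : Momentum L b, modeNumber siteAnnih z.neg φ = modeNumber siteAnnih z φ) ∧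
      (∀ z : Momentum L b, (z : ℂ) = 1 → modeNumber siteAnnih z φ = φ) ∧
      (∀ z : Momentum L b, (z : ℂ) = -1 → modeNumber siteAnnih z φ = 0))
    (by
      rintro φ w ⟨h1, h2, h3, h4⟩
      refine ⟨modeNumber_mem h1 w, fun z => ?_, fun z hz => ?_, fun z hz => ?_⟩
      · rw [hc', h2, hc']
      · rw [hc', h3 z hz]
      · rw [hc', h4 z hz, map_zero])
    ψ
    (by
      rw [abs_lt] at hμ
      refine ⟨hε, hψ.modeNumber_neg isCAR_siteAnnih hΔ, fun z hz => ?_, fun z hz => ?_⟩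
      · refine hψ.modeNumber_eq_self isCAR_siteAnnih ?_ ?_ <;> rw [hz] <;> simp
        linarith
      · refine hψ.modeNumber_eq_zero ?_ ?_ <;> rw [hz] <;> simp
        linarith)
    h0
  classical
  let e : Momentum L b → ℕ := fun z => if modeNumber siteAnnih z φ = 0 then 0 else 1
  have he : ∀ z : Momentum L b, modeNumber siteAnnih z φ = (e z : ℂ) • φ := by
    intro z
    by_cases h : modeNumber siteAnnih z φ = 0
    · simp [e, h]
    · simp only [e, if_neg h, Nat.cast_one, one_smul]
      exact (h6 z).resolve_left h
  have hneg : ∀ z, e z.neg = e z := fun z => by simp only [e, h2]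
  have hone : ∀ z : Momentum L b, (z : ℂ) = 1 → e z = 1 := fun z hz => by
    simp only [e, h3 z hz, if_neg h5]
  have hmone : ∀ z : Momentum L b, (z : ℂ) = -1 → e z = 0 := fun z hz => by
    simp only [e, h4 z hz, if_true]
  have hsum : siteNumber siteAnnih φ = ((∑ z, e z : ℕ) : ℂ) • φ := by
    rw [siteNumber_eq_sum_modeNumber b, LinearMap.sum_apply, Nat.cast_sum, Finset.sum_smul]
    exact Finset.sum_congr rfl fun z _ => he z
  -- The wire number is diagonal in the occupation basis, so any configuration present in `φ` has as
  -- many particles as the occupied modes.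
  obtain ⟨S, hS⟩ : ∃ S, φ S ≠ 0 := by
    by_contra! h
    exact h5 (by ext S; exact h S)
  have hcard : S.card = ∑ z, e z := by
    have h := congrArg (fun x : Fock L => x S) hsum
    simp only [siteNumber_apply, PiLp.smul_apply, smul_eq_mul] at h
    exact Nat.cast_injective (R := ℂ) (mul_right_cancel₀ hS h)
  have hεS : (S.card : ZMod 2) = ε := by
    by_contra h
    exact hS (h1 S h)
  -- Subtracting the indicator of `z = 1` makes the summand vanish at the fixed points `z = ±1` of
  -- the involution `z ↦ -k`, so everything cancels in pairs modulo 2.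
  have hpair : ∑ z : Momentum L b, ((e z : ZMod 2) - if (z : ℂ) = 1 then 1 else 0) = 0 := by
    refine Finset.sum_involution (fun z _ => z.neg) ?_ ?_ (fun _ _ => Finset.mem_univ _)
      (fun z _ => z.neg_neg)
    · intro z _
      have : ((z.neg : ℂ) = 1) ↔ ((z : ℂ) = 1) := by
        rw [Momentum.coe_neg, star_eq_iff_star_eq, star_one, eq_comm]
      simp only [hneg, this]
      exact CharTwo.add_self_eq_zero _
    · intro z _ hz hz'
      apply hz
      have him : (z : ℂ).im = 0 := Complex.conj_eq_iff_im.1 (congrArg Subtype.val hz')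
      rcases z.coe_eq_one_or_of_im_eq_zero him with h | h
      · simp [hone z h, h]
      · rw [hmone z h, h, if_neg (by norm_num)]
        simp
  rw [Finset.sum_sub_distrib, Momentum.sum_ite_eq_one, sub_eq_zero] at hpair
  rw [← hεS, hcard, Nat.cast_sum, hpair]

theorem lowering_siteAnnih_mem [NeZero L] {ε : ZMod 2} {φ : Fock L}
    (hφ : φ ∈ paritySubspace L ε) (t Δ μ : ℝ) (z : Momentum L b) :
    lowering t Δ μ siteAnnih z φ ∈ paritySubspace L (ε + 1) :=
  Submodule.add_mem _ (Submodule.smul_mem _ _ (mode_siteAnnih_mem hφ z))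
    (Submodule.smul_mem _ _ (star_mode_siteAnnih_mem hφ z.neg))

theorem loweringStar_siteAnnih_mem [NeZero L] {ε : ZMod 2} {φ : Fock L}
    (hφ : φ ∈ paritySubspace L ε) (t Δ μ : ℝ) (z : Momentum L b) :
    loweringStar t Δ μ siteAnnih z φ ∈ paritySubspace L (ε + 1) :=
  Submodule.add_mem _ (Submodule.smul_mem _ _ (star_mode_siteAnnih_mem hφ z))
    (Submodule.smul_mem _ _ (mode_siteAnnih_mem hφ z.neg))

theorem kitaev_siteAnnih_mem [NeZero L] {ε : ZMod 2} {φ : Fock L}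
    (hφ : φ ∈ paritySubspace L ε) (b : Boundary) (t Δ μ : ℝ) :
    kitaev b siteAnnih t Δ μ φ ∈ paritySubspace L ε := by
  have h2 : ∀ {T U : Module.End ℂ (Fock L)}, (∀ ε, ∀ χ ∈ paritySubspace L ε,
      T χ ∈ paritySubspace L (ε + 1)) → (∀ ε, ∀ χ ∈ paritySubspace L ε,
      U χ ∈ paritySubspace L (ε + 1)) → (T * U) φ ∈ paritySubspace L ε := by
    intro T U hT hU
    have := hT _ _ (hU _ _ hφ)
    rwa [add_one_add_one] at this
  have hm : ∀ z : Momentum L b, ∀ ε, ∀ χ ∈ paritySubspace L ε,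
      mode siteAnnih z χ ∈ paritySubspace L (ε + 1) := fun z ε χ hχ => mode_siteAnnih_mem hχ z
  have hs : ∀ z : Momentum L b, ∀ ε, ∀ χ ∈ paritySubspace L ε,
      star (mode siteAnnih z) χ ∈ paritySubspace L (ε + 1) :=
    fun z ε χ hχ => star_mode_siteAnnih_mem hχ z
  rw [kitaev_eq_sum_mode, LinearMap.add_apply, LinearMap.sum_apply]
  refine Submodule.add_mem _ (Submodule.sum_mem _ fun z _ => ?_) (Submodule.smul_mem _ _ hφ)
  refine Submodule.add_mem _ (Submodule.smul_mem _ _ (h2 (hs z) (hm z)))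
    (Submodule.smul_mem _ _ (Submodule.add_mem _ (Submodule.smul_mem _ _ (h2 (hm z) (hm z.neg)))
      (Submodule.smul_mem _ _ (h2 (hs z.neg) (hs z)))))

/-! ### Lowest eigenvalue on an invariant subspace -/

section Bottom

variable {V : Type*} [NormedAddCommGroup V] [InnerProductSpace ℂ V] [FiniteDimensional ℂ V]
  {T : Module.End ℂ V} {U : Submodule ℂ V} {e : ℝ}

/-- `e` is the lowest eigenvalue of `T` on the subspace `U`. -/
structure IsBottom (T : Module.End ℂ V) (U : Submodule ℂ V) (e : ℝ) : Prop where
  exists_eigenvector : ∃ φ ∈ U, φ ≠ 0 ∧ T φ = (e : ℂ) • φ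
  le_inner : ∀ φ ∈ U, e * ‖φ‖ ^ 2 ≤ (⟪φ, T φ⟫_ℂ).re

/-- In finite dimension the infimum of the Rayleigh quotient of the restriction is an eigenvalue. -/
theorem exists_isBottom (hT : star T = T) (hU : ∀ φ ∈ U, T φ ∈ U) (h0 : ∃ φ ∈ U, φ ≠ 0) :
    ∃ e, IsBottom T U e := by
  have hsymm : T.IsSymmetric := fun x y => by
    conv_lhs => rw [← hT]
    exact inner_star_apply T x y
  have hsymm' := hsymm.restrict_invariant hU
  have hnt : Nontrivial U := by
    obtain ⟨φ, h1, h2⟩ := h0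
    exact ⟨⟨⟨φ, h1⟩, 0, fun h => h2 (congrArg Subtype.val h)⟩⟩
  obtain ⟨v, hv⟩ := hsymm'.hasEigenvalue_iInf_of_finiteDimensional.exists_hasEigenvector
  refine ⟨_, ⟨v, v.2, fun h => hv.2 (Subtype.ext h), congrArg Subtype.val hv.apply_eq_smul⟩, ?_⟩
  intro φ hφ
  rcases eq_or_ne φ 0 with rfl | hne
  · simp
  have hpos : 0 < ‖φ‖ ^ 2 := by positivity
  rw [← le_div_iff₀ hpos]
  -- A real infimum is a lower bound only for sets bounded below; the operator norm supplies the
  -- bound.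
  have hbdd : BddBelow (Set.range fun x : {x : U // x ≠ 0} =>
      RCLike.re ⟪T.restrict hU x, (x : U)⟫_ℂ / ‖(x : U)‖ ^ 2) := by
    refine ⟨-‖LinearMap.toContinuousLinearMap T‖, ?_⟩
    rintro _ ⟨x, rfl⟩
    have hx : 0 < ‖(x : U)‖ ^ 2 := by
      have := norm_pos_iff.2 x.2
      positivity
    rw [le_div_iff₀ hx]
    have h1 := neg_le_of_abs_le ((RCLike.abs_re_le_norm _).trans
      (norm_inner_le_norm (𝕜 := ℂ) (T.restrict hU x) (x : U)))
    have h2 : ‖T.restrict hU x‖ ≤ ‖LinearMap.toContinuousLinearMap T‖ * ‖(x : U)‖ :=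
      (LinearMap.toContinuousLinearMap T).le_opNorm ((x : U) : V)
    nlinarith [norm_nonneg (x : U)]
  have h := ciInf_le hbdd ⟨⟨φ, hφ⟩, fun h => hne (congrArg Subtype.val h)⟩
  refine h.trans (le_of_eq ?_)
  congr 1
  exact congrArg Complex.re (hsymm φ φ)

theorem re_inner_eigenvector {φ : V} (h : T φ = (e : ℂ) • φ) :
    (⟪φ, T φ⟫_ℂ).re = e * ‖φ‖ ^ 2 := by
  rw [h, inner_smul_right, Complex.re_ofReal_mul]
  exact congrArg (e * ·) (inner_self_eq_norm_sq (𝕜 := ℂ) φ)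

theorem IsBottom.le_of_eigenvector (h : IsBottom T U e) {φ : V} (hφ : φ ∈ U) (h0 : φ ≠ 0) {e' : ℝ}
    (hT : T φ = (e' : ℂ) • φ) : e ≤ e' := by
  have h1 := h.le_inner φ hφ
  rw [re_inner_eigenvector hT] at h1
  have : 0 < ‖φ‖ ^ 2 := by positivity
  exact le_of_mul_le_mul_right h1 this

theorem IsBottom.le_of_le_inner {T' : Module.End ℂ V} {e' : ℝ} (h : IsBottom T' U e')
    (h' : ∀ φ ∈ U, e * ‖φ‖ ^ 2 ≤ (⟪φ, T' φ⟫_ℂ).re) : e ≤ e' := by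
  obtain ⟨φ, h1, h2, h3⟩ := h.exists_eigenvector
  have h4 := h' φ h1
  rw [re_inner_eigenvector h3] at h4
  have : 0 < ‖φ‖ ^ 2 := by positivity
  exact le_of_mul_le_mul_right h4 this

end Bottom

/-! ### Energy gap between the parities without charging energy -/

section SectorEnergies

variable [NeZero L] {t Δ μ : ℝ}

theorem exists_mem_paritySubspace_ne_zero (ε : ZMod 2) :
    ∃ φ ∈ paritySubspace L ε, φ ≠ 0 := by
  obtain ⟨S, hS⟩ : ∃ S : Finset (Fin L), (S.card : ZMod 2) = ε := by
    have hε : ε = 0 ∨ ε = 1 := by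
      revert ε
      decide
    rcases hε with rfl | rfl
    · exact ⟨∅, by simp⟩
    · exact ⟨{0}, by simp⟩
  refine ⟨EuclideanSpace.single S 1, fun S' hS' => ?_, fun h => ?_⟩
  · rw [PiLp.single_apply, if_neg]
    rintro rfl
    exact hS' hS
  · have := congrArg (fun x : Fock L => x S) h
    simp at this

theorem exists_isBottom_kitaev (b : Boundary) (t Δ μ : ℝ) (ε : ZMod 2) :
    ∃ e, IsBottom (kitaev b (siteAnnih (L := L)) t Δ μ) (paritySubspace L ε) e :=
  exists_isBottom (kitaev_isSelfAdjoint _ _ _ _ _) (fun _ h => kitaev_siteAnnih_mem h _ _ _ _)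
    (exists_mem_paritySubspace_ne_zero ε)

/-- A state of definite parity and energy that is not a vacuum can be lowered to a state of opposite
parity. -/
theorem exists_lower_of_not_isVacuum {φ : Fock L} {e : ℝ} {ε : ZMod 2}
    (hφ : φ ∈ paritySubspace L ε) (he : kitaev b siteAnnih t Δ μ φ = (e : ℂ) • φ)
    (hv : ¬ IsVacuum b siteAnnih t Δ μ φ) :
    ∃ (z : Momentum L b), ∃ χ ∈ paritySubspace L (ε + 1), χ ≠ 0 ∧
      kitaev b siteAnnih t Δ μ χ = ((e - z.energy t Δ μ : ℝ) : ℂ) • χ := by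
  have key : ∀ (z : Momentum L b) (B : Module.End ℂ (Fock L)),
      kitaev b siteAnnih t Δ μ * B = B * kitaev b siteAnnih t Δ μ - (z.energy t Δ μ : ℂ) • B →
      kitaev b siteAnnih t Δ μ (B φ) = ((e - z.energy t Δ μ : ℝ) : ℂ) • B φ := by
    intro z B hB
    have h := congrArg (fun T : Module.End ℂ (Fock L) => T φ) hB
    simp only [LinearMap.sub_apply, Module.End.mul_apply, LinearMap.smul_apply, he, map_smul] at h
    rw [h, ← sub_smul, Complex.ofReal_sub]
  obtain ⟨z, hz⟩ := not_forall.1 hv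
  by_cases h : lowering t Δ μ siteAnnih z φ = 0
  · exact ⟨z, _, loweringStar_siteAnnih_mem hφ t Δ μ z, fun h' => hz ⟨h, h'⟩,
      key z _ (kitaev_mul_loweringStar isCAR_siteAnnih t Δ μ z)⟩
  · exact ⟨z, _, lowering_siteAnnih_mem hφ t Δ μ z, h,
      key z _ (kitaev_mul_lowering isCAR_siteAnnih t Δ μ z)⟩

section Gap

variable {Emin eR eW : ℝ}

/-- The lowest state of the wrong parity cannot be a vacuum, so lowering it gives a state of the
right parity with energy smaller by at least `Emin`. -/
theorem kitaev_gap (hΔ : Δ ≠ 0) (hμ : |μ| < t)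
    (hmin : ∀ z : Momentum L b, Emin ≤ z.energy t Δ μ)
    (hR : IsBottom (kitaev b siteAnnih t Δ μ) (paritySubspace L b.groundParity) eR)
    (hW : IsBottom (kitaev b siteAnnih t Δ μ) (paritySubspace L (b.groundParity + 1)) eW) :
    eR + Emin ≤ eW := by
  obtain ⟨φ, h1, h2, h3⟩ := hW.exists_eigenvector
  have hv : ¬ IsVacuum b siteAnnih t Δ μ φ := fun h => by
    have := h.parity_eq hΔ hμ h2 h1
    simp at this
  obtain ⟨z, χ, h4, h5, h6⟩ := exists_lower_of_not_isVacuum h1 h3 hv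
  rw [add_one_add_one] at h4
  have := hR.le_of_eigenvector h4 h5 h6
  linarith [hmin z]

/-- If the lowest state of the right parity could be lowered, a state of the wrong parity would lie
below it, against `kitaev_gap`. -/
theorem exists_vacuum (hpos : 0 < Emin) (hΔ : Δ ≠ 0) (hμ : |μ| < t)
    (hmin : ∀ z : Momentum L b, Emin ≤ z.energy t Δ μ)
    (hR : IsBottom (kitaev b siteAnnih t Δ μ) (paritySubspace L b.groundParity) eR) :
    ∃ ψ ∈ paritySubspace L b.groundParity, ‖ψ‖ = 1 ∧
      kitaev b siteAnnih t Δ μ ψ = (eR : ℂ) • ψ ∧ IsVacuum b siteAnnih t Δ μ ψ := by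
  obtain ⟨eW, hW⟩ := exists_isBottom_kitaev (L := L) b t Δ μ (b.groundParity + 1)
  have hgap := kitaev_gap hΔ hμ hmin hR hW
  obtain ⟨φ, h1, h2, h3⟩ := hR.exists_eigenvector
  have hne : (‖φ‖ : ℂ)⁻¹ ≠ 0 := by simpa using h2
  refine ⟨(‖φ‖ : ℂ)⁻¹ • φ, Submodule.smul_mem _ _ h1, ?_, ?_, ?_⟩
  · exact norm_smul_inv_norm h2
  · rw [map_smul, h3, smul_comm]
  · have h1' := Submodule.smul_mem _ (‖φ‖ : ℂ)⁻¹ h1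
    have h3' : kitaev b siteAnnih t Δ μ ((‖φ‖ : ℂ)⁻¹ • φ) = (eR : ℂ) • (‖φ‖ : ℂ)⁻¹ • φ := by
      rw [map_smul, h3, smul_comm]
    by_contra hv
    obtain ⟨z, χ, h4, h5, h6⟩ := exists_lower_of_not_isVacuum h1' h3' hv
    have := hW.le_of_eigenvector h4 h5 h6
    linarith [hmin z]

end Gap

/-! ### Charging energy in a sector of fixed particle number -/

/-- The deviation of the particle number of the wire from `a`. -/
def numberDeviation (L : ℕ) (a : ℝ) : Module.End ℂ (Fock L) :=
  siteNumber siteAnnih - (a : ℂ) • (1 : Module.End ℂ (Fock L))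

/-- The Hamiltonian of the `M`-particle sector, on Fock space. -/
def sectorHamiltonian (L : ℕ) (b : Boundary) (t Δ μ Ec nc : ℝ) (M : ℤ) :
    Module.End ℂ (Fock L) :=
  kitaev b siteAnnih t Δ μ
    + (Ec : ℂ) • numberDeviation L (M - 2 * nc) ^ 2

section Sector

variable {Ec nc : ℝ} {M : ℤ}

theorem star_siteNumber {V : Type*} [NormedAddCommGroup V] [InnerProductSpace ℂ V]
    [FiniteDimensional ℂ V] (c : Fin L → Module.End ℂ V) : star (siteNumber c) = siteNumber c := by
  simp only [siteNumber, star_sum, star_mul, star_star]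

theorem star_numberDeviation (a : ℝ) :
    star (numberDeviation L a) = numberDeviation L a := by
  rw [numberDeviation, star_sub, star_siteNumber, star_smul, star_one, Complex.star_def,
    Complex.conj_ofReal]

theorem star_sectorHamiltonian :
    star (sectorHamiltonian L b t Δ μ Ec nc M) = sectorHamiltonian L b t Δ μ Ec nc M := by
  rw [sectorHamiltonian, star_add, kitaev_isSelfAdjoint, star_smul, star_pow, star_numberDeviation,
    Complex.star_def, Complex.conj_ofReal]

theorem numberDeviation_apply (a : ℝ) (φ : Fock L) (S : Finset (Fin L)) :
    numberDeviation L a φ S = ((S.card - a : ℝ) : ℂ) * φ S := by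
  rw [numberDeviation, LinearMap.sub_apply, PiLp.sub_apply, siteNumber_apply]
  simp [sub_mul]

theorem sectorHamiltonian_mem {ε : ZMod 2} {φ : Fock L} (hφ : φ ∈ paritySubspace L ε) :
    sectorHamiltonian L b t Δ μ Ec nc M φ ∈ paritySubspace L ε := by
  refine Submodule.add_mem _ (kitaev_siteAnnih_mem hφ _ _ _ _) (Submodule.smul_mem _ _ ?_)
  intro S hS
  rw [pow_two, Module.End.mul_apply, numberDeviation_apply, numberDeviation_apply, hφ S hS]
  simp

theorem re_inner_sectorHamiltonian (φ : Fock L) :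
    (⟪φ, sectorHamiltonian L b t Δ μ Ec nc M φ⟫_ℂ).re
      = (⟪φ, kitaev b siteAnnih t Δ μ φ⟫_ℂ).re
        + Ec * ∑ S, ((S.card : ℝ) - (M - 2 * nc)) ^ 2 * ‖φ S‖ ^ 2 := by
  rw [sectorHamiltonian, LinearMap.add_apply, inner_add_right, Complex.add_re, LinearMap.smul_apply,
    inner_smul_right, Complex.re_ofReal_mul, pow_two, Module.End.mul_apply]
  congr 2
  rw [← star_numberDeviation, inner_star_apply_right, star_numberDeviation]
  have h : ‖numberDeviation L (M - 2 * nc) φ‖ ^ 2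
      = ∑ S, ((S.card : ℝ) - (M - 2 * nc)) ^ 2 * ‖φ S‖ ^ 2 := by
    rw [EuclideanSpace.norm_sq_eq]
    refine Finset.sum_congr rfl fun S _ => ?_
    rw [numberDeviation_apply, norm_mul, mul_pow, Complex.norm_real, Real.norm_eq_abs, sq_abs]
  rw [← h]
  exact inner_self_eq_norm_sq (𝕜 := ℂ) _

theorem le_re_inner_sectorHamiltonian (hEc : 0 ≤ Ec) {e : ℝ} {φ : Fock L}
    (h : e * ‖φ‖ ^ 2 ≤ (⟪φ, kitaev b siteAnnih t Δ μ φ⟫_ℂ).re) :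
    e * ‖φ‖ ^ 2 ≤ (⟪φ, sectorHamiltonian L b t Δ μ Ec nc M φ⟫_ℂ).re := by
  rw [re_inner_sectorHamiltonian]
  have : 0 ≤ Ec * ∑ S, ((S.card : ℝ) - (M - 2 * nc)) ^ 2 * ‖φ S‖ ^ 2 := by positivity
  linarith

/-- From `(n - m)² ≥ m²/2 - n²` and `n ≤ L`. For `Ec > 0` the sector energies thus grow with `|M|`,
so a minimum over all sectors exists. -/
theorem le_re_inner_sectorHamiltonian_of_coercive (hEc : 0 ≤ Ec) {e : ℝ} {φ : Fock L}
    (h : e * ‖φ‖ ^ 2 ≤ (⟪φ, kitaev b siteAnnih t Δ μ φ⟫_ℂ).re) :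
    (e + Ec * ((M - 2 * nc) ^ 2 / 2 - L ^ 2)) * ‖φ‖ ^ 2
      ≤ (⟪φ, sectorHamiltonian L b t Δ μ Ec nc M φ⟫_ℂ).re := by
  rw [re_inner_sectorHamiltonian, add_mul, mul_assoc]
  refine add_le_add h (mul_le_mul_of_nonneg_left ?_ hEc)
  rw [EuclideanSpace.norm_sq_eq, Finset.mul_sum]
  refine Finset.sum_le_sum fun S _ => mul_le_mul_of_nonneg_right ?_ (by positivity)
  have h1 : (S.card : ℝ) ≤ L := by
    exact_mod_cast (Finset.card_le_univ S).trans_eq (Fintype.card_fin L)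
  have h2 : (0 : ℝ) ≤ S.card := Nat.cast_nonneg _
  nlinarith [sq_nonneg ((S.card : ℝ) - (M - 2 * nc) / 2 + S.card - (M - 2 * nc) / 2)]

theorem exists_isBottom_sectorHamiltonian (L : ℕ) [NeZero L] (b : Boundary) (t Δ μ Ec nc : ℝ)
    (M : ℤ) (ε : ZMod 2) :
    ∃ e, IsBottom (sectorHamiltonian L b t Δ μ Ec nc M) (paritySubspace L ε) e :=
  exists_isBottom star_sectorHamiltonian (fun _ h => sectorHamiltonian_mem h)
    (exists_mem_paritySubspace_ne_zero ε)

/-- The mean square deviation from `M - 2 n_c` is the variance, at most `L/2`, plus the squared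
offset of the mean. -/
theorem IsVacuum.re_inner_sectorHamiltonian_le {e : ℝ} {ψ : Fock L} (hEc : 0 ≤ Ec) (hΔ : Δ ≠ 0)
    (hμ : |μ| < t) (hn : ‖ψ‖ = 1) (he : kitaev b siteAnnih t Δ μ ψ = (e : ℂ) • ψ)
    (hψ : IsVacuum b siteAnnih t Δ μ ψ) :
    (⟪ψ, sectorHamiltonian L b t Δ μ Ec nc M ψ⟫_ℂ).re
      ≤ e + Ec * (L / 2 + (meanNumber L b t Δ μ + 2 * nc - M) ^ 2) := by
  have h1 := hψ.inner_siteNumber isCAR_siteAnnih hΔ hμ hn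
  have h2 := hψ.inner_siteNumber_sq_le isCAR_siteAnnih hΔ hμ hn
  have h3 : ⟪ψ, (numberDeviation L (M - 2 * nc) ^ 2) ψ⟫_ℂ
      = ⟪ψ, siteNumber siteAnnih (siteNumber siteAnnih ψ)⟫_ℂ
        + ((-2 * (M - 2 * nc) * meanNumber L b t Δ μ + (M - 2 * nc) ^ 2 : ℝ) : ℂ) := by
    have h4 : ⟪ψ, ψ⟫_ℂ = 1 := by rw [inner_self_eq_norm_sq_to_K, hn]; simp
    rw [pow_two, Module.End.mul_apply, numberDeviation]
    simp only [LinearMap.sub_apply, LinearMap.smul_apply, Module.End.one_apply, map_sub, map_smul,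
      inner_sub_right, inner_smul_right, h1, h4]
    push_cast
    ring
  rw [sectorHamiltonian, LinearMap.add_apply, inner_add_right, Complex.add_re,
    re_inner_eigenvector he, hn, LinearMap.smul_apply, inner_smul_right, Complex.re_ofReal_mul, h3,
    Complex.add_re, Complex.ofReal_re]
  have : Ec * ((⟪ψ, siteNumber siteAnnih (siteNumber siteAnnih ψ)⟫_ℂ).re
      + (-2 * (M - 2 * nc) * meanNumber L b t Δ μ + (M - 2 * nc) ^ 2))
      ≤ Ec * (L / 2 + (meanNumber L b t Δ μ + 2 * nc - M) ^ 2) := by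
    refine mul_le_mul_of_nonneg_left ?_ hEc
    linarith
  linarith

/-- Among the sectors of given parity, one has the lowest energy. -/
theorem exists_lowest_sector (hEc : 0 ≤ Ec) {ε : ZMod 2} {e : ℤ → ℝ}
    (he : ∀ M, IsBottom (sectorHamiltonian L b t Δ μ Ec nc M) (paritySubspace L M) (e M)) :
    ∃ M : ℤ, (M : ZMod 2) = ε ∧ ∀ M' : ℤ, (M' : ZMod 2) = ε → e M ≤ e M' := by
  obtain ⟨M₁, hM₁⟩ : ∃ M : ℤ, (M : ZMod 2) = ε := ZMod.intCast_surjective ε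
  -- Without charging energy the sector Hamiltonian does not depend on `M`, so any sector of the
  -- given parity is lowest; otherwise coercivity leaves finitely many candidates.
  rcases hEc.eq_or_lt with rfl | hEc'
  · refine ⟨M₁, hM₁, fun M' hM' => ?_⟩
    have h1 := he M₁
    have h2 := he M'
    rw [hM₁] at h1
    rw [hM'] at h2
    refine h2.le_of_le_inner fun φ hφ => ?_
    have := h1.le_inner φ hφ
    rw [re_inner_sectorHamiltonian] at this ⊢
    simpa using this
  obtain ⟨eK, hK⟩ := exists_isBottom_kitaev (L := L) b t Δ μ ε
  have hlow : ∀ M : ℤ, (M : ZMod 2) = ε → eK + Ec * ((M - 2 * nc) ^ 2 / 2 - L ^ 2) ≤ e M := by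
    intro M hM
    have h := he M
    rw [hM] at h
    exact h.le_of_le_inner fun φ hφ =>
      le_re_inner_sectorHamiltonian_of_coercive hEc (hK.le_inner φ hφ)
  have hfin : {M : ℤ | (M : ZMod 2) = ε ∧ e M ≤ e M₁}.Finite := by
    set C : ℝ := 2 * ((e M₁ - eK) / Ec + L ^ 2)
    refine (Set.finite_Icc (⌊2 * nc - (C + 1)⌋) (⌈2 * nc + (C + 1)⌉)).subset ?_
    rintro M ⟨h1, h2⟩
    have h3 := (hlow M h1).trans h2
    have h4 : ((M : ℝ) - 2 * nc) ^ 2 ≤ C := by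
      have : (M - 2 * nc) ^ 2 / 2 - (L : ℝ) ^ 2 ≤ (e M₁ - eK) / Ec := by
        rw [le_div_iff₀ hEc']
        linarith
      simp only [C]
      linarith
    constructor
    · have : 2 * nc - (C + 1) ≤ M := by nlinarith [sq_nonneg ((M : ℝ) - 2 * nc + 1)]
      exact_mod_cast (Int.floor_le _).trans this
    · have : (M : ℝ) ≤ 2 * nc + (C + 1) := by nlinarith [sq_nonneg ((M : ℝ) - 2 * nc - 1)]
      exact_mod_cast this.trans (Int.le_ceil _)
  obtain ⟨M, hM, hmin⟩ := Set.exists_min_image _ e hfin ⟨M₁, hM₁, le_rfl⟩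
  refine ⟨M, hM.1, fun M' hM' => ?_⟩
  rcases le_total (e M') (e M₁) with h | h
  · exact hmin M' ⟨hM', h⟩
  · exact hM.2.trans h

theorem exists_int_parity_near (x : ℝ) (ε : ZMod 2) :
    ∃ M : ℤ, (M : ZMod 2) = ε ∧ (x - M) ^ 2 ≤ 1 := by
  obtain ⟨g, hg⟩ : ∃ M : ℤ, (M : ZMod 2) = ε := ZMod.intCast_surjective ε
  refine ⟨2 * round ((x - g) / 2) + g, ?_, ?_⟩
  · have h2 : (2 : ZMod 2) = 0 := rfl
    push_cast
    rw [hg, h2, zero_mul, zero_add]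
  · have h := abs_le.1 (abs_sub_round ((x - g) / 2))
    push_cast
    nlinarith [h.1, h.2]

/-- The vacuum serves as a trial state in the sector that best fits its mean number. Admissible `M`
are spaced by 2, so the offset is at most 1. -/
theorem exists_sector_energy_le {Emin eR : ℝ} (hEc : 0 ≤ Ec) (hpos : 0 < Emin) (hΔ : Δ ≠ 0)
    (hμ : |μ| < t) (hmin : ∀ z : Momentum L b, Emin ≤ z.energy t Δ μ)
    (hR : IsBottom (kitaev b siteAnnih t Δ μ) (paritySubspace L b.groundParity) eR) {e : ℤ → ℝ}
    (he : ∀ M, IsBottom (sectorHamiltonian L b t Δ μ Ec nc M) (paritySubspace L M) (e M)) :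
    ∃ M : ℤ, (M : ZMod 2) = b.groundParity ∧ e M ≤ eR + Ec * (L / 2 + 1) := by
  obtain ⟨ψ, h1, h2, h3, h4⟩ := exists_vacuum hpos hΔ hμ hmin hR
  obtain ⟨M, hM, hM'⟩ := exists_int_parity_near (meanNumber L b t Δ μ + 2 * nc) b.groundParity
  refine ⟨M, hM, ?_⟩
  have h5 := (he M).le_inner ψ (by rwa [hM])
  have h6 := h4.re_inner_sectorHamiltonian_le (nc := nc) (M := M) hEc hΔ hμ h2 h3
  rw [h2] at h5
  have := mul_le_mul_of_nonneg_left (add_le_add_right hM' (L / 2 : ℝ)) hEc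
  linarith

end Sector

end SectorEnergies

/-! ### Decomposition of the Hilbert space into sectors -/

/-- The restriction of a family of amplitudes to the `M`-particle sector, as a state of the wire. -/
def sector (M : ℤ) : (Config L → ℂ) →ₗ[ℂ] Fock L where
  toFun ψ := WithLp.toLp 2 fun S =>
    if (2 : ℤ) ∣ M - S.card then ψ (S, (M - S.card) / 2) else 0
  map_add' ψ χ := by
    ext S
    by_cases h : (2 : ℤ) ∣ M - S.card <;> simp [h]
  map_smul' a ψ := by
    ext S
    by_cases h : (2 : ℤ) ∣ M - S.card <;> simp [h]

theorem sector_apply (M : ℤ) (ψ : Config L → ℂ) (S : Finset (Fin L)) :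
    sector M ψ S = if (2 : ℤ) ∣ M - S.card then ψ (S, (M - S.card) / 2) else 0 := rfl

theorem sector_apply_self (ψ : Config L → ℂ) (x : Config L) :
    sector (x.1.card + 2 * x.2) ψ x.1 = ψ x := by
  rw [sector_apply, add_sub_cancel_left, if_pos (dvd_mul_right _ _),
    Int.mul_ediv_cancel_left _ two_ne_zero]

theorem ext_sector {ψ χ : Config L → ℂ} (h : ∀ M, sector M ψ = sector M χ) : ψ = χ := by
  funext x
  rw [← sector_apply_self ψ, h, sector_apply_self]

theorem sector_mem (M : ℤ) (ψ : Config L → ℂ) : sector M ψ ∈ paritySubspace L (M : ZMod 2) := by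
  intro S hS
  rw [sector_apply, if_neg]
  intro h
  apply hS
  have := (ZMod.intCast_zmod_eq_zero_iff_dvd (M - S.card) 2).2 (by exact_mod_cast h)
  push_cast at this
  exact (sub_eq_zero.1 this).symm

theorem sector_annih (M : ℤ) (j : Fin L) (ψ : Config L → ℂ) :
    sector M (annih j ψ) = siteAnnih j (sector (M + 1) ψ) := by
  ext S
  rw [siteAnnih_apply, sector_apply]
  simp only [annih, LinearMap.coe_mk, AddHom.coe_mk]
  by_cases h : j ∈ S
  · simp [h]
  · have hc : M + 1 - ((insert j S).card : ℤ) = M - S.card := by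
      rw [Finset.card_insert_of_notMem h]
      push_cast
      ring
    rw [if_neg h, if_neg h, sector_apply, hc, mul_ite, mul_zero]

theorem sector_create (M : ℤ) (j : Fin L) (ψ : Config L → ℂ) :
    sector M (create j ψ) = star (siteAnnih j) (sector (M - 1) ψ) := by
  ext S
  rw [star_siteAnnih, siteCreate_apply, sector_apply]
  simp only [create, LinearMap.coe_mk, AddHom.coe_mk]
  by_cases h : j ∈ S
  · have hc : M - 1 - ((S.erase j).card : ℤ) = M - S.card := by
      rw [← Finset.card_erase_add_one h]
      push_cast
      ring
    rw [if_pos h, if_pos h, sector_apply, hc, mul_ite, mul_zero]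
  · simp [h]

/-- The phase factor leaves the wire alone and only relabels the sector; this is how it disappears
from the sector Hamiltonian. -/
theorem sector_expPhase (M d : ℤ) (ψ : Config L → ℂ) :
    sector M (expPhase d ψ) = sector (M - 2 * d) ψ := by
  ext S
  rw [sector_apply, sector_apply]
  simp only [expPhase, LinearMap.coe_mk, AddHom.coe_mk]
  have h1 : M - 2 * d - (S.card : ℤ) = M - S.card - 2 * d := by ring
  by_cases h : (2 : ℤ) ∣ M - S.card
  · rw [if_pos h, h1, if_pos (dvd_sub h (dvd_mul_right _ _))]
    congr 2
    omega
  · rw [if_neg h, h1, if_neg]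
    intro h'
    exact h (by simpa using dvd_add h' (dvd_mul_right 2 d))

theorem sector_pairNumber (M : ℤ) (ψ : Config L → ℂ) :
    (2 : ℂ) • sector M (pairNumber L ψ)
      = (M : ℂ) • sector M ψ - siteNumber siteAnnih (sector M ψ) := by
  ext S
  rw [PiLp.sub_apply, siteNumber_apply, PiLp.smul_apply, PiLp.smul_apply, sector_apply,
    sector_apply]
  simp only [pairNumber, LinearMap.coe_mk, AddHom.coe_mk, smul_eq_mul]
  split_ifs with h
  · obtain ⟨k, hk⟩ := h
    rw [hk, Int.mul_ediv_cancel_left _ two_ne_zero]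
    have : (M : ℂ) - S.card = 2 * k := by exact_mod_cast hk
    linear_combination (-ψ (S, k)) * this
  · simp

theorem sector_annihNext (M : ℤ) (j : Fin L) (ψ : Config L → ℂ) :
    sector M (annihNext b j ψ) = next b siteAnnih j (sector (M + 1) ψ) := by
  rw [annihNext, next]
  split_ifs
  · exact sector_annih _ _ _
  · rw [LinearMap.smul_apply, LinearMap.smul_apply, map_smul, sector_annih]

theorem sector_createNext (M : ℤ) (j : Fin L) (ψ : Config L → ℂ) :
    sector M (createNext b j ψ) = star (next b siteAnnih j) (sector (M - 1) ψ) := by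
  rw [createNext, next]
  split_ifs
  · exact sector_create _ _ _
  · rw [LinearMap.smul_apply, star_smul, LinearMap.smul_apply, map_smul, sector_create,
      Boundary.star_sign]

theorem sector_formalH0 (M : ℤ) (t Δ μ : ℝ) (ψ : Config L → ℂ) :
    sector M (formalH0 L b t Δ μ ψ) = kitaev b siteAnnih t Δ μ (sector M ψ) := by
  -- In the pairing terms the two particles removed from or added to the wire are compensated by one
  -- Cooper pair, so the total number returns to `M`.
  have h2 : M + 1 + 1 - 2 = M := by ring
  have h3 : M + 2 - 1 - 1 = M := by ring
  simp only [formalH0, kitaev, wireNumber, LinearMap.add_apply, LinearMap.sub_apply,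
    LinearMap.smul_apply, LinearMap.sum_apply, Module.End.mul_apply, Module.End.one_apply, map_add,
    map_sub, map_smul, map_sum, sector_annih, sector_create, sector_annihNext, sector_createNext,
    sector_expPhase, sub_add_cancel, mul_one, mul_neg, sub_neg_eq_add, h2, h3]

theorem sector_chargingEnergy (M : ℤ) (Ec nc : ℝ) (ψ : Config L → ℂ) :
    sector M (chargingEnergy L Ec nc ψ)
      = (Ec : ℂ) • (numberDeviation L (M - 2 * nc) ^ 2) (sector M ψ) := by
  have h1 : ∀ χ : Config L → ℂ, sector M (((2 : ℂ) • pairNumber L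
      - (2 * (nc : ℂ)) • (1 : FormalOp L)) χ) = -numberDeviation L (M - 2 * nc) (sector M χ) := by
    intro χ
    rw [LinearMap.sub_apply, LinearMap.smul_apply, map_sub, map_smul, sector_pairNumber,
      numberDeviation]
    simp only [LinearMap.smul_apply, LinearMap.sub_apply, Module.End.one_apply, map_smul]
    push_cast
    module
  rw [chargingEnergy, LinearMap.smul_apply, map_smul, pow_two, Module.End.mul_apply, h1, h1,
    map_neg, neg_neg, pow_two, Module.End.mul_apply]

/-- The expression of the Hamiltonian on formal families of amplitudes. -/
abbrev formalHamiltonian (L : ℕ) (b : Boundary) (t Δ μ Ec nc : ℝ) : FormalOp L :=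
  formalH0 L b t Δ μ + chargingEnergy L Ec nc

theorem sector_formalHamiltonian (M : ℤ) (t Δ μ Ec nc : ℝ) (ψ : Config L → ℂ) :
    sector M (formalHamiltonian L b t Δ μ Ec nc ψ)
      = sectorHamiltonian L b t Δ μ Ec nc M (sector M ψ) := by
  rw [formalHamiltonian, LinearMap.add_apply, map_add, sector_formalH0, sector_chargingEnergy,
    sectorHamiltonian, LinearMap.add_apply, LinearMap.smul_apply]

/-- The domain condition is automatic: `A ψ = E ψ` is square summable because `ψ` is. -/
theorem isEigenstate_maximalOp_iff {A : FormalOp L} {E : ℝ} {ψ : HilbertSpace L} :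
    IsEigenstate (maximalOp A) E ψ
      ↔ ψ ≠ 0 ∧ A (ψ : Config L → ℂ) = (E : ℂ) • (ψ : Config L → ℂ) := by
  refine and_congr_right fun _ => ⟨?_, ?_⟩
  · rintro ⟨h1, h2⟩
    exact congrArg (fun χ : HilbertSpace L => (χ : Config L → ℂ)) h2
  · intro h
    have h1 : Memℓp (A (ψ : Config L → ℂ)) 2 := by
      rw [h]
      exact (lp.memℓp ψ).const_smul _
    exact ⟨h1, Subtype.ext h⟩

/-- The state of the `M`-particle sector with given amplitudes on the wire. -/
def liftSector (M : ℤ) (φ : Fock L) : HilbertSpace L :=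
  ⟨fun x => if (x.1.card : ℤ) + 2 * x.2 = M then φ x.1 else 0, by
    -- Each `S` occurs with at most one pair number, so the support is finite.
    refine (memℓp_zero ?_).of_exponent_ge zero_le
    refine (Set.finite_range fun S : Finset (Fin L) => ((S, (M - S.card) / 2) : Config L)).subset ?_
    rintro ⟨S, p⟩ h
    refine ⟨S, Prod.ext rfl ?_⟩
    have h' : (S.card : ℤ) + 2 * p = M := by
      by_contra h'
      exact h (if_neg h')
    change (M - S.card) / 2 = p
    omega⟩

theorem liftSector_apply (M : ℤ) (φ : Fock L) (x : Config L) :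
    liftSector M φ x = if (x.1.card : ℤ) + 2 * x.2 = M then φ x.1 else 0 := rfl

/-- The parity of `φ` matters: amplitudes on sets of the other parity have no configuration in the
sector and would be lost. -/
theorem sector_liftSector {M : ℤ} {φ : Fock L} (hφ : φ ∈ paritySubspace L (M : ZMod 2)) (M' : ℤ) :
    sector M' (liftSector M φ : Config L → ℂ) = if M' = M then φ else 0 := by
  ext S
  rw [sector_apply, liftSector_apply]
  rcases eq_or_ne M' M with rfl | h
  · rw [if_pos rfl]
    split_ifs with h1 h2
    · rfl
    · exact absurd h2 (by simp only; omega)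
    · refine (hφ S fun h => h1 ?_).symm
      have : ((M' - S.card : ℤ) : ZMod 2) = 0 := by
        push_cast
        rw [h, sub_self]
      exact_mod_cast (ZMod.intCast_zmod_eq_zero_iff_dvd _ 2).1 this
  · rw [if_neg h]
    split_ifs with h1 h2
    · exact absurd h2 (by simp only; omega)
    · rfl
    · rfl

/-- The amplitudes of `ψ` are supported on configurations of parity `ε`. -/
def HasParity (ε : ZMod 2) (ψ : HilbertSpace L) : Prop :=
  ∀ x : Config L, ψ x ≠ 0 → (x.1.card : ZMod 2) = ε

theorem numberParity_apply (ψ : Config L → ℂ) (x : Config L) :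
    numberParity L ψ x = (-1) ^ x.1.card * ψ x := by
  simp only [numberParity, LinearMap.coe_mk, AddHom.coe_mk]
  rw [zpow_add₀ (by norm_num), zpow_mul]
  simp

theorem evenParity_iff {ψ : HilbertSpace L} : EvenParity ψ ↔ HasParity 0 ψ := by
  rw [EvenParity, funext_iff, HasParity]
  refine forall_congr' fun x => ?_
  rw [numberParity_apply, ZMod.natCast_eq_zero_iff_even]
  rcases Nat.even_or_odd x.1.card with h | h
  · simp [h, h.neg_one_pow]
  · simp [h.neg_one_pow, Nat.not_even_iff_odd.2 h, neg_eq_self]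

theorem oddParity_iff {ψ : HilbertSpace L} : OddParity ψ ↔ HasParity 1 ψ := by
  rw [OddParity, funext_iff, HasParity]
  refine forall_congr' fun x => ?_
  rw [numberParity_apply, ZMod.natCast_eq_one_iff_odd]
  rcases Nat.even_or_odd x.1.card with h | h
  · simp [h.neg_one_pow, Nat.not_odd_iff_even.2 h, self_eq_neg]
  · simp [h, h.neg_one_pow]

theorem wireNumber_apply (ψ : Config L → ℂ) (x : Config L) :
    wireNumber L ψ x = (x.1.card : ℂ) * ψ x := by
  have h : ∀ j : Fin L, (create j * annih j) ψ x = if j ∈ x.1 then ψ x else 0 := by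
    intro j
    simp only [Module.End.mul_apply, create, annih, LinearMap.coe_mk, AddHom.coe_mk]
    split_ifs with h1 h2
    · simp at h2
    · rw [Finset.insert_erase h1, jwSign_erase_of_le _ le_rfl, ← mul_assoc, jwSign_mul_self,
        one_mul]
    · rfl
  rw [wireNumber, LinearMap.sum_apply, Finset.sum_apply]
  simp only [h, Finset.sum_ite_mem, Finset.univ_inter, Finset.sum_const, nsmul_eq_mul]

theorem inSector_liftSector (M : ℤ) (φ : Fock L) : InSector M (liftSector M φ) := by
  funext x
  rw [totalNumber, LinearMap.add_apply, Pi.add_apply, wireNumber_apply]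
  simp only [LinearMap.smul_apply, Pi.smul_apply, pairNumber, LinearMap.coe_mk, AddHom.coe_mk,
    liftSector_apply, smul_eq_mul]
  split_ifs with h
  · have : (x.1.card : ℂ) + 2 * x.2 = M := by exact_mod_cast h
    rw [← this]
    ring
  · simp

theorem hasParity_liftSector {M : ℤ} {φ : Fock L} {ε : ZMod 2} (hM : (M : ZMod 2) = ε) :
    HasParity ε (liftSector M φ) := by
  intro x hx
  have h : (x.1.card : ℤ) + 2 * x.2 = M := by
    by_contra h
    exact hx (if_neg h)
  have h2 : (2 : ZMod 2) = 0 := rfl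
  rw [← hM, ← h]
  push_cast
  rw [h2, zero_mul, add_zero]

/-! ### From sector energies to the spectrum of the ring -/

section Spectrum

variable {t Δ μ Ec nc : ℝ}

theorem isEigenstate_liftSector {M : ℤ} {φ : Fock L} {E : ℝ}
    (hφ : φ ∈ paritySubspace L (M : ZMod 2)) (h0 : φ ≠ 0)
    (hE : sectorHamiltonian L b t Δ μ Ec nc M φ = (E : ℂ) • φ) :
    IsEigenstate (maximalOp (formalHamiltonian L b t Δ μ Ec nc)) E (liftSector M φ) := by
  have hs := sector_liftSector hφ
  rw [isEigenstate_maximalOp_iff]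
  refine ⟨fun h => h0 ?_, ext_sector fun M' => ?_⟩
  · have := hs M
    rw [h, if_pos rfl, lp.coeFn_zero, map_zero] at this
    exact this.symm
  · rw [sector_formalHamiltonian, map_smul, hs]
    split_ifs with h
    · rw [h, hE]
    · simp

/-- An eigenstate need not have a definite particle number, but each of its nonzero sector
components is an eigenvector with the same energy. -/
theorem IsEigenstate.exists_sector_le {ψ : HilbertSpace L} {E : ℝ} {e : ℤ → ℝ}
    (he : ∀ M, IsBottom (sectorHamiltonian L b t Δ μ Ec nc M) (paritySubspace L M) (e M))
    (hψ : IsEigenstate (maximalOp (formalHamiltonian L b t Δ μ Ec nc)) E ψ) {x : Config L}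
    (hx : ψ x ≠ 0) : ∃ M : ℤ, (M : ZMod 2) = x.1.card ∧ e M ≤ E := by
  rw [isEigenstate_maximalOp_iff] at hψ
  refine ⟨x.1.card + 2 * x.2, ?_, ?_⟩
  · have h2 : (2 : ZMod 2) = 0 := rfl
    push_cast
    rw [h2, zero_mul, add_zero]
  · refine (he _).le_of_eigenvector (sector_mem _ ψ) (fun h => hx ?_) ?_
    · rw [← sector_apply_self (ψ : Config L → ℂ) x, h]
      rfl
    · rw [← sector_formalHamiltonian, hψ.2, map_smul]

theorem exists_ne_zero {ψ : HilbertSpace L} (h : ψ ≠ 0) : ∃ x, ψ x ≠ 0 := by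
  by_contra! h'
  exact h (lp.ext (funext h'))

/-- The parity switch, with the sectors labelled by their parity in `ZMod 2`. -/
theorem parity_switch [NeZero L] {Emin : ℝ} (hEc : 0 ≤ Ec) (hΔ : Δ ≠ 0) (hμ : |μ| < t)
    (hmin : ∀ z : Momentum L b, Emin ≤ z.energy t Δ μ) (hgap : Ec * (L / 2 + 1) < Emin) :
    ∃ E₀ E₁ : ℝ,
      (∃ (M : ℤ) (ψ : HilbertSpace L), (M : ZMod 2) = b.groundParity ∧ InSector M ψ ∧
        IsGroundState (maximalOp (formalHamiltonian L b t Δ μ Ec nc)) E₀ ψ) ∧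
      (∀ ψ : HilbertSpace L,
        IsGroundState (maximalOp (formalHamiltonian L b t Δ μ Ec nc)) E₀ ψ →
        HasParity b.groundParity ψ) ∧
      IsLeast {E : ℝ | ∃ ψ : HilbertSpace L, HasParity (b.groundParity + 1) ψ ∧
        IsEigenstate (maximalOp (formalHamiltonian L b t Δ μ Ec nc)) E ψ} E₁ ∧
      Emin - Ec * (L / 2 + 1) ≤ E₁ - E₀ := by
  have hpos : 0 < Emin := lt_of_le_of_lt (by positivity) hgap
  obtain ⟨eR, hR⟩ := exists_isBottom_kitaev (L := L) b t Δ μ b.groundParity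
  obtain ⟨eW, hW⟩ := exists_isBottom_kitaev (L := L) b t Δ μ (b.groundParity + 1)
  have hRW := kitaev_gap hΔ hμ hmin hR hW
  choose e he using fun M : ℤ =>
    exists_isBottom_sectorHamiltonian L b t Δ μ Ec nc M (M : ZMod 2)
  obtain ⟨M₀, hM₀, h0⟩ := exists_lowest_sector (ε := b.groundParity) hEc he
  obtain ⟨M₁, hM₁, h1⟩ := exists_lowest_sector (ε := b.groundParity + 1) hEc he
  obtain ⟨M, hM, hle⟩ := exists_sector_energy_le hEc hpos hΔ hμ hmin hR he
  have hupper : e M₀ ≤ eR + Ec * (L / 2 + 1) := (h0 M hM).trans hle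
  -- Together with `hRW`, `hupper` and `hgap` this gives `e M₀ < e M₁`, with difference at least
  -- `Emin - Ec * (L / 2 + 1)`.
  have hlower : eW ≤ e M₁ := by
    have h := he M₁
    rw [hM₁] at h
    exact h.le_of_le_inner fun φ hφ => le_re_inner_sectorHamiltonian hEc (hW.le_inner φ hφ)
  have hdich : ∀ a : ZMod 2, a = b.groundParity ∨ a = b.groundParity + 1 := by
    intro a
    generalize b.groundParity = c
    revert a c
    decide
  obtain ⟨φ₀, hφ₀, hne₀, heq₀⟩ := (he M₀).exists_eigenvector
  obtain ⟨φ₁, hφ₁, hne₁, heq₁⟩ := (he M₁).exists_eigenvector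
  refine ⟨e M₀, e M₁, ⟨M₀, liftSector M₀ φ₀, hM₀, inSector_liftSector _ _,
    isEigenstate_liftSector hφ₀ hne₀ heq₀, ?_⟩, ?_, ⟨⟨liftSector M₁ φ₁, hasParity_liftSector hM₁,
    isEigenstate_liftSector hφ₁ hne₁ heq₁⟩, ?_⟩, ?_⟩
  · intro E' χ hχ
    obtain ⟨x, hx⟩ := exists_ne_zero hχ.1
    obtain ⟨M', hM', hle'⟩ := hχ.exists_sector_le he hx
    rcases hdich M' with h | h
    · exact (h0 M' h).trans hle'
    · linarith [h1 M' h]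
  -- A nonzero amplitude of the wrong parity would force the ground state energy up to at least `e
  -- M₁ > e M₀`.
  · intro ψ hψ x hx
    obtain ⟨M', hM', hle'⟩ := hψ.1.exists_sector_le he hx
    rw [← hM']
    refine (hdich M').resolve_right fun h => ?_
    linarith [h1 M' h]
  · rintro E ⟨ψ, hψ, hE⟩
    obtain ⟨x, hx⟩ := exists_ne_zero hE.1
    obtain ⟨M', hM', hle'⟩ := hE.exists_sector_le he hx
    exact (h1 M' (hM'.trans (hψ x hx))).trans hle'
  · linarith

end Spectrum

/-! ### The minimal excitation energy and the final constants -/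

theorem minDispersion_le_energy [NeZero L] (t Δ μ : ℝ) (z : Momentum L b) :
    minDispersion t Δ μ ≤ z.energy t Δ μ := by
  have hz : ‖(z : ℂ)‖ = 1 := by
    have h := Complex.conj_mul' (z : ℂ)
    rw [← Complex.star_def, z.star_mul_self] at h
    have h' : ‖(z : ℂ)‖ ^ 2 = 1 := by exact_mod_cast h.symm
    exact (pow_eq_one_iff_of_nonneg (norm_nonneg _) two_ne_zero).1 h'
  have hre : Real.cos (Complex.arg z) = (z : ℂ).re := by
    have := Complex.norm_mul_cos_arg (z : ℂ)
    rwa [hz, one_mul] at this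
  have him : Real.sin (Complex.arg z) = (z : ℂ).im := by
    have := Complex.norm_mul_sin_arg (z : ℂ)
    rwa [hz, one_mul] at this
  -- `arg` takes values in `(-π, π]`, so `-arg` lies in `[-π, π)`
  have hmem : -Complex.arg z ∈ Set.Ico (-Real.pi) Real.pi :=
    ⟨neg_le_neg (Complex.arg_le_pi _), by linarith [Complex.neg_pi_lt_arg (z : ℂ)]⟩
  refine ((isLeast_minDispersion t Δ μ).2 ⟨_, hmem, rfl⟩).trans_eq ?_
  rw [dispersion, Momentum.energy, Real.cos_neg, Real.sin_neg, hre, him, neg_sq, mul_pow]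

/-- For `Δ = 0` the dispersion vanishes at the momentum with `cos k = -μ/t`, which is real because
`|μ| < t`. -/
theorem ne_zero_of_minDispersion_pos {t Δ μ : ℝ} (hμ : |μ| < t) (h : 0 < minDispersion t Δ μ) :
    Δ ≠ 0 := by
  rintro rfl
  have ht : 0 < t := (abs_nonneg μ).trans_lt hμ
  rw [abs_lt] at hμ
  have hcos : Real.cos (Real.arccos (-μ / t)) = -μ / t :=
    Real.cos_arccos (by rw [le_div_iff₀ ht]; linarith) (by rw [div_le_one ht]; linarith)
  have hmem : -Real.arccos (-μ / t) ∈ Set.Ico (-Real.pi) Real.pi :=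
    ⟨neg_le_neg (Real.arccos_le_pi _), by
      linarith [Real.arccos_nonneg (-μ / t), Real.pi_pos]⟩
  have hle := (isLeast_minDispersion t 0 μ).2 ⟨_, hmem, rfl⟩
  rw [dispersion, Real.cos_neg, hcos, mul_div_cancel₀ _ ht.ne'] at hle
  simp at hle
  linarith

theorem parity_switch_hamiltonian (b : Boundary) (hL : 0 < L) {t Δ μ Ecal : ℝ} (nc : ℝ)
    (hμ : |μ| < t) (hE : 0 ≤ Ecal)
    (hgap : Ecal * (1 / 2 + 9 / (L : ℝ)) < minDispersion t Δ μ) :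
    ∃ E₀ E₁ : ℝ,
      (∃ (M : ℤ) (ψ : HilbertSpace L), (M : ZMod 2) = b.groundParity ∧ InSector M ψ ∧
        IsGroundState (hamiltonian L b t Δ μ Ecal nc) E₀ ψ) ∧
      (∀ ψ : HilbertSpace L,
        IsGroundState (hamiltonian L b t Δ μ Ecal nc) E₀ ψ → HasParity b.groundParity ψ) ∧
      IsLeast {E : ℝ | ∃ ψ : HilbertSpace L, HasParity (b.groundParity + 1) ψ ∧
        IsEigenstate (hamiltonian L b t Δ μ Ecal nc) E ψ} E₁ ∧
      E₁ - E₀ ≥ minDispersion t Δ μ - Ecal * (1 / 2 + 9 / (L : ℝ)) := by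
  have : NeZero L := ⟨hL.ne'⟩
  have hL' : (0 : ℝ) < L := Nat.cast_pos.2 hL
  -- The argument yields `1/2 + 1/L`; the constant 9 in the statement leaves room to spare.
  have hle : Ecal / L * (L / 2 + 1) ≤ Ecal * (1 / 2 + 9 / (L : ℝ)) := by
    have h1 : Ecal / L * (L / 2 + 1) = Ecal * (1 / 2 + 1 / L) := by
      field_simp
    rw [h1]
    gcongr
    norm_num
  have hpos : 0 < minDispersion t Δ μ := lt_of_le_of_lt (by positivity) hgap
  obtain ⟨E₀, E₁, h1, h2, h3, h4⟩ := parity_switch (b := b) (nc := nc) (div_nonneg hE hL'.le)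
    (ne_zero_of_minDispersion_pos hμ hpos) hμ (minDispersion_le_energy t Δ μ) (hle.trans_lt hgap)
  exact ⟨E₀, E₁, h1, h2, h3, by linarith⟩

end KitaevRing

end

theorem theorem5 (L : ℕ) (hL_pos : 0 < L) (hL_even : Even L) (t Δ μ Ecal nc : ℝ)
    (hμ : |μ| < t) (hE : 0 ≤ Ecal)
    (hgap : Ecal * (1 / 2 + 9 / (L : ℝ)) < KitaevRing.minDispersion t Δ μ) :
    -- periodic boundary conditions: the ground states have odd total particle number
    (∃ E₀ E₁ : ℝ,
      (∃ (M : ℤ) (ψ : KitaevRing.HilbertSpace L), Odd M ∧ KitaevRing.InSector M ψ ∧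
        KitaevRing.IsGroundState
          (KitaevRing.hamiltonian L KitaevRing.Boundary.periodic t Δ μ Ecal nc) E₀ ψ) ∧
      (∀ ψ : KitaevRing.HilbertSpace L,
        KitaevRing.IsGroundState
          (KitaevRing.hamiltonian L KitaevRing.Boundary.periodic t Δ μ Ecal nc) E₀ ψ →
        KitaevRing.OddParity ψ) ∧
      IsLeast {E : ℝ | ∃ ψ : KitaevRing.HilbertSpace L, KitaevRing.EvenParity ψ ∧
        KitaevRing.IsEigenstate
          (KitaevRing.hamiltonian L KitaevRing.Boundary.periodic t Δ μ Ecal nc) E ψ} E₁ ∧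
      E₁ - E₀ ≥ KitaevRing.minDispersion t Δ μ - Ecal * (1 / 2 + 9 / (L : ℝ))) ∧
    -- antiperiodic boundary conditions: the ground states have even total particle number
    (∃ E₀ E₁ : ℝ,
      (∃ (M : ℤ) (ψ : KitaevRing.HilbertSpace L), Even M ∧ KitaevRing.InSector M ψ ∧
        KitaevRing.IsGroundState
          (KitaevRing.hamiltonian L KitaevRing.Boundary.antiperiodic t Δ μ Ecal nc) E₀ ψ) ∧
      (∀ ψ : KitaevRing.HilbertSpace L,
        KitaevRing.IsGroundState
          (KitaevRing.hamiltonian L KitaevRing.Boundary.antiperiodic t Δ μ Ecal nc) E₀ ψ →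
        KitaevRing.EvenParity ψ) ∧
      IsLeast {E : ℝ | ∃ ψ : KitaevRing.HilbertSpace L, KitaevRing.OddParity ψ ∧
        KitaevRing.IsEigenstate
          (KitaevRing.hamiltonian L KitaevRing.Boundary.antiperiodic t Δ μ Ecal nc) E ψ} E₁ ∧
      E₁ - E₀ ≥ KitaevRing.minDispersion t Δ μ - Ecal * (1 / 2 + 9 / (L : ℝ))) ∧
    -- the lower bound is `E_min - 𝓔_c / 2 + O(1 / L)` as `L → ∞`
    (fun n : ℕ => (KitaevRing.minDispersion t Δ μ - Ecal * (1 / 2 + 9 / (n : ℝ)))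
        - (KitaevRing.minDispersion t Δ μ - Ecal / 2))
      =O[Filter.atTop] (fun n : ℕ => 1 / (n : ℝ)) := by
  refine ⟨?_, ?_, ?_⟩
  · obtain ⟨E₀, E₁, ⟨M, ψ, hM, hψ⟩, h2, h3, h4⟩ :=
      KitaevRing.parity_switch_hamiltonian .periodic hL_pos nc hμ hE hgap
    refine ⟨E₀, E₁, ⟨M, ψ, ZMod.intCast_eq_one_iff_odd.1 hM, hψ⟩,
      fun ψ hψ => KitaevRing.oddParity_iff.2 (h2 ψ hψ), ?_, h4⟩
    simp only [KitaevRing.evenParity_iff]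
    exact h3
  · obtain ⟨E₀, E₁, ⟨M, ψ, hM, hψ⟩, h2, h3, h4⟩ :=
      KitaevRing.parity_switch_hamiltonian .antiperiodic hL_pos nc hμ hE hgap
    refine ⟨E₀, E₁, ⟨M, ψ, ZMod.intCast_eq_zero_iff_even.1 hM, hψ⟩,
      fun ψ hψ => KitaevRing.evenParity_iff.2 (h2 ψ hψ), ?_, h4⟩
    simp only [KitaevRing.oddParity_iff]
    exact h3
  · have h : (fun n : ℕ => (KitaevRing.minDispersion t Δ μ - Ecal * (1 / 2 + 9 / (n : ℝ)))
        - (KitaevRing.minDispersion t Δ μ - Ecal / 2)) =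
        fun n : ℕ => -9 * Ecal * (1 / (n : ℝ)) := by
      funext n
      ring
    rw [h]
    exact Asymptotics.isBigO_const_mul_self _ _ _
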